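/- Let $\Omega=(a,b)$ be a bounded interval and $T>0$. Let $\nu>0$ and let $\phi$ be a weak solution on $(0,T)$ of the convection-diffusion problem $\partial_t\phi+\partial_x(u\phi)-\nu\partial_x^2\phi=f$ in $\Omega\times(0,T)$, $\nu\,\partial_n\phi-\phi\,u\cdot n=g$ on $\partial\Omega\times(0,T)$, $\phi(0)=\phi^0$, that is, for all $t\in(0,T)$ and $\psi\in\Psi:=H^1(\Omega)$, $$(\partial_t\phi(t),\psi)+\nu(\partial_x\phi(t),\partial_x\psi)-(\phi(t),u(t)\,\partial_x\psi)=(f(t),\psi)+g(a,t)\psi(a)+g(b,t)\psi(b),$$ where $(\cdot,\cdot)$ is the $L^2(\Omega)$ inner product, $u(t),f(t)\in L^2(\Omega)$, and $\phi(t)$ is identified with its continuous representative on $\bar\Omega$. Assume that $\phi\in C^j([0,T];H^{3-j}(\Omega))$ for $j=0,1,2,3$ and $\phi\in H^2(0,T;H^2(\Omega))\cap H^1(0,T;H^3(\Omega))$. Let $\Delta t>0$, $t^n=n\Delta t$, $N_T=\lfloor T/\Delta t\rfloor$, and let a moving mesh be given: $N_p\ge 2$ points with $a=P_1^n<P_2^n<\dots<P_{N_p}^n=b$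 for $n=0,\dots,N_T$. Put $h=\max_{n,i}(P_{i+1}^n-P_i^n)$, $w_i^n=(P_i^n-P_i^{n-1})/\Delta t$ and $P_i(t)=P_i^{n-1}+w_i^n(t-t^{n-1})$ for $t\in[t^{n-1},t^n]$. Let $\psi_i(\cdot,t)$ be the continuous function that is affine on every $[P_j(t),P_{j+1}(t)]$ with $\psi_i(P_j(t),t)=\delta_{ij}$, let $w(\cdot,t)=\sum_i w_i^n\psi_i(\cdot,t)$ for $t\in[t^{n-1},t^n]$ be the mesh velocity, and let $\Pi_h(t)v=\sum_i v(P_i(t))\psi_i(\cdot,t)$, $\Pi_h^n=\Pi_h(t^n)$, be the Lagrange interpolation. Let $\|w\|_{C(L^\infty)}$ and $\|w\|_{C(W^{1,\infty})}$ denote the suprema over $n=1,\dots,N_T$ and $t\in[t^{n-1},t^n]$ of the norms of $w(\cdot,t)$ in $L^\infty(\Omega)$ and $W^{1,\infty}(\Omega)$. For $n=1,\dots,N_T$ let $$A^n=\frac{\Pi_h^n\phi(t^n)-\Pi_h^{n-1}\phi(t^{n-1})}{\Delta t}-\frac1{\Delta t}\int_{t^{n-1}}^{t^n}\Pi_h(t)\,\partial_t\phi(\cdot,t)\,dt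 .$$ Then $A^n$ is well defined (on $\bar\Omega$ the derivative $\partial_t\phi$ exists at all $t\in(t^{n-1},t^n)$, and the integrand is integrable in time at every point of $\bar\Omega$), it belongs to $L^2(\Omega)$, and for all $n=1,\dots,N_T$: (i) there is a positive constant $C$ depending only on $\|w\|_{C(L^\infty)}$ such that $$\|A^n\|_{L^2(\Omega)}\le \frac{C\,h}{\sqrt{\Delta t}}\,\|\phi\|_{L^2(t^{n-1},t^n;H^2(\Omega))};$$ (ii) there is a positive constant $C'$ depending only on $T$ and $\|w\|_{C(W^{1,\infty})}$ such that $$\|A^n\|_{\Psi'}\le C'\,h^2\,\|\phi\|_{H^1(0,T;H^3(\Omega))},\qquad \|A^n\|_{\Psi'}=\sup\{|(A^n,v)|:\ v\in H^1(\Omega),\ \|v\|_{H^1(\Omega)}\le1\}.$$ In particular $C$ and $C'$ do not depend on $\Delta t$, the mesh, $\phi$ or the data. -/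

import Mathlib

open MeasureTheory Set Filter Topology
open scoped ENNReal ContDiff

noncomputable section

/-- `g` is the weak derivative of `f` on the interval `(a, b)`, for functions with values in a
Banach space `Y` (the integrals are Bochner integrals): `∫ ζ' f = - ∫ ζ g` for every smooth
real-valued `ζ` with compact support in `(a, b)`. -/
def HasWeakDerivOn {Y : Type*} [NormedAddCommGroup Y] [NormedSpace ℝ Y]
    (a b : ℝ) (f g : ℝ → Y) : Prop :=
  ∀ ζ : ℝ → ℝ, ContDiff ℝ ∞ ζ → HasCompactSupport ζ → tsupport ζ ⊆ Ioo a b →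
    ∫ s in Ioo a b, deriv ζ s • f s = - ∫ s in Ioo a b, ζ s • g s

/-- The ambient space `L²(a, b; Y)^(m+1)` with the norm `(∑ ‖F i‖²)^(1/2)`. -/
abbrev L2Jets (Y : Type*) [NormedAddCommGroup Y] [NormedSpace ℝ Y] (m : ℕ) (a b : ℝ) : Type _ :=
  PiLp 2 (fun _ : Fin (m + 1) => Lp Y 2 (volume.restrict (Ioo a b)))

theorem integral_smul_eq_lpPairing {Y : Type*} [NormedAddCommGroup Y] [NormedSpace ℝ Y]
    [CompleteSpace Y] (a b : ℝ) (ρ : ℝ → ℝ) (hρ : Continuous ρ) (hc : HasCompactSupport ρ) :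
    ∃ T : Lp Y 2 (volume.restrict (Ioo a b)) →L[ℝ] Y,
      ∀ f, T f = ∫ s in Ioo a b, ρ s • f s := by
  have hm : MemLp ρ 2 (volume.restrict (Ioo a b)) := hρ.memLp_of_hasCompactSupport hc
  refine ⟨(ContinuousLinearMap.lsmul ℝ ℝ : ℝ →L[ℝ] Y →L[ℝ] Y).lpPairing
    (volume.restrict (Ioo a b)) 2 2 (hm.toLp ρ), fun f => ?_⟩
  rw [ContinuousLinearMap.lpPairing_eq_integral]
  refine integral_congr_ae ?_
  filter_upwards [hm.coeFn_toLp] with s hs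
  simp [hs]

theorem hasWeakDerivOn_iff {Y : Type*} [NormedAddCommGroup Y] [NormedSpace ℝ Y]
    [CompleteSpace Y] (a b : ℝ) (ζ : ℝ → ℝ) (h1 : ContDiff ℝ ∞ ζ) (h2 : HasCompactSupport ζ) :
    ∃ T S : Lp Y 2 (volume.restrict (Ioo a b)) →L[ℝ] Y,
      (∀ f, T f = ∫ s in Ioo a b, deriv ζ s • f s) ∧ ∀ f, S f = ∫ s in Ioo a b, ζ s • f s := by
  obtain ⟨T, hT⟩ := integral_smul_eq_lpPairing (Y := Y) a b (deriv ζ)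
    (h1.continuous_deriv (by simp)) h2.deriv
  obtain ⟨S, hS⟩ := integral_smul_eq_lpPairing (Y := Y) a b ζ h1.continuous h2
  exact ⟨T, S, hT, hS⟩

/-- The Sobolev space `H^m(a, b; Y)` of `Y`-valued functions, as the space of all tuples
`(f, f', …, f^(m))` of an `L²` function and its successive weak derivatives, all in `L²(a, b; Y)`.
As the weak derivatives are determined by `f`, this is the usual space, and the norm it
inherits is the usual norm `(∑_{i ≤ m} ‖f^(i)‖²)^(1/2)`. -/
def sobolevSubmodule (Y : Type*) [NormedAddCommGroup Y] [NormedSpace ℝ Y] [CompleteSpace Y]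
    (m : ℕ) (a b : ℝ) : Submodule ℝ (L2Jets Y m a b) where
  carrier := {F | ∀ i : Fin m, HasWeakDerivOn a b (F i.castSucc) (F i.succ)}
  zero_mem' := by
    intro i ζ h1 h2 h3
    obtain ⟨T, S, hT, hS⟩ := hasWeakDerivOn_iff (Y := Y) a b ζ h1 h2
    rw [← hT, ← hS]; simp
  add_mem' := by
    intro F G hF hG i ζ h1 h2 h3
    obtain ⟨T, S, hT, hS⟩ := hasWeakDerivOn_iff (Y := Y) a b ζ h1 h2
    have e1 := hF i ζ h1 h2 h3
    have e2 := hG i ζ h1 h2 h3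
    rw [← hT, ← hS] at e1 e2 ⊢
    simp only [PiLp.add_apply, map_add, e1, e2]
    abel
  smul_mem' := by
    intro c F hF i ζ h1 h2 h3
    obtain ⟨T, S, hT, hS⟩ := hasWeakDerivOn_iff (Y := Y) a b ζ h1 h2
    have e1 := hF i ζ h1 h2 h3
    rw [← hT, ← hS] at e1 ⊢
    simp [e1]

/-- The Banach space `H^m(a, b; Y)`. -/
abbrev Sobolev (Y : Type*) [NormedAddCommGroup Y] [NormedSpace ℝ Y] [CompleteSpace Y]
    (m : ℕ) (a b : ℝ) : Type _ :=
  ↥(sobolevSubmodule Y m a b)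

/-- Completeness is what makes Bochner integrals of `H^m`-valued functions meaningful. -/
instance instCompleteSpaceSobolev (Y : Type*) [NormedAddCommGroup Y] [NormedSpace ℝ Y]
    [CompleteSpace Y] (m : ℕ) (a b : ℝ) : CompleteSpace (Sobolev Y m a b) := by
  have hcl : IsClosed (sobolevSubmodule Y m a b : Set (L2Jets Y m a b)) := by
    have : (sobolevSubmodule Y m a b : Set (L2Jets Y m a b)) =
        ⋂ (i : Fin m) (ζ : ℝ → ℝ) (_ : ContDiff ℝ ∞ ζ) (_ : HasCompactSupport ζ)
          (_ : tsupport ζ ⊆ Ioo a b),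
          {F : L2Jets Y m a b | ∫ s in Ioo a b, deriv ζ s • F i.castSucc s
            = - ∫ s in Ioo a b, ζ s • F i.succ s} := by
      ext F
      simp only [mem_iInter]
      exact Iff.rfl
    rw [this]
    refine isClosed_iInter fun i => isClosed_iInter fun ζ => isClosed_iInter fun h1 =>
      isClosed_iInter fun h2 => isClosed_iInter fun _ => ?_
    obtain ⟨T, S, hT, hS⟩ := hasWeakDerivOn_iff (Y := Y) a b ζ h1 h2
    simp only [← hT, ← hS]
    exact isClosed_eq (T.continuous.comp (PiLp.continuous_apply 2 _ _))
      (S.continuous.comp (PiLp.continuous_apply 2 _ _)).neg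
  exact hcl.completeSpace_coe

/-- The space `H^m(a, b)` of real-valued functions. -/
abbrev HSob (m : ℕ) (a b : ℝ) : Type := Sobolev ℝ m a b

/-- The `i`-th weak derivative of `F ∈ H^m(a, b; Y)`; `i = 0` gives the function itself. -/
def Sobolev.jet {Y : Type*} [NormedAddCommGroup Y] [NormedSpace ℝ Y] [CompleteSpace Y]
    {m : ℕ} {a b : ℝ} (F : Sobolev Y m a b) (i : Fin (m + 1)) : ℝ → Y :=
  ((F : L2Jets Y m a b) i : ℝ → Y)

/-- The function `f` belongs to the class `F ∈ H^m(a, b)`. -/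
def Represents {m : ℕ} {a b : ℝ} (F : HSob m a b) (f : ℝ → ℝ) : Prop :=
  F.jet 0 =ᵐ[volume.restrict (Ioo a b)] f

/-- The function `φ`, `φ t x` with `t ∈ (t₀, t₁)` and `x ∈ (a, b)`, belongs to the class
`F ∈ H^k(t₀, t₁; H^m(a, b))`. -/
def TimeRepresents {k m : ℕ} {t₀ t₁ a b : ℝ} (F : Sobolev (HSob m a b) k t₀ t₁)
    (φ : ℝ → ℝ → ℝ) : Prop :=
  ∀ᵐ t ∂(volume.restrict (Ioo t₀ t₁)), Represents (F.jet 0 t) (φ t)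

/-- `φ ∈ H^k(t₀, t₁; H^m(a, b))`. -/
def MemTimeSobolev (k : ℕ) (t₀ t₁ : ℝ) (m : ℕ) (a b : ℝ) (φ : ℝ → ℝ → ℝ) : Prop :=
  ∃ F : Sobolev (HSob m a b) k t₀ t₁, TimeRepresents F φ

/-- The norm of `φ` in `H^k(t₀, t₁; H^m(a, b))`, equal to `∞` if `φ` is not in this space.
(At most one class `F` contains `φ`.) -/
def timeSobolevNorm (k : ℕ) (t₀ t₁ : ℝ) (m : ℕ) (a b : ℝ) (φ : ℝ → ℝ → ℝ) : ℝ≥0∞ :=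
  ⨅ (F : Sobolev (HSob m a b) k t₀ t₁) (_ : TimeRepresents F φ), ‖F‖ₑ

/-- `φ ∈ C^j([0, T]; H^m(a, b))`. -/
def MemTimeC (j : ℕ) (T : ℝ) (m : ℕ) (a b : ℝ) (φ : ℝ → ℝ → ℝ) : Prop :=
  ∃ F : ℝ → HSob m a b, (∀ t ∈ Icc 0 T, Represents (F t) (φ t)) ∧ ContDiffOn ℝ j F (Icc 0 T)

/-- `φ ∈ Z^m`, i.e. `φ ∈ C^j([0, T]; H^(m-j)(a, b))` for `j = 0, …, m`. The corresponding norm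
is automatically finite, as `[0, T]` is compact. -/
def MemZ (m : ℕ) (T a b : ℝ) (φ : ℝ → ℝ → ℝ) : Prop :=
  ∀ j ≤ m, MemTimeC j T (m - j) a b φ

/-- The norm of `A` in the dual of `H¹(a, b)`, where `A` acts by the `L²` inner product. -/
def dualNorm (a b : ℝ) (A : ℝ → ℝ) : ℝ≥0∞ :=
  ⨆ (v : HSob 1 a b) (_ : ‖v‖ ≤ 1), ‖∫ x in Ioo a b, A x * v.jet 0 x‖ₑ

/-- The partial derivative `∂φ/∂t`. -/
def timeDeriv (φ : ℝ → ℝ → ℝ) (t x : ℝ) : ℝ := deriv (fun s => φ s x) t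

/-- `φ` is a weak solution of the convection-diffusion problem
`∂φ/∂t + ∇·(uφ) - νΔφ = f` in `(a, b) × (0, T)`, `ν ∂φ/∂n - φ u·n = g` on `{a, b} × (0, T)`,
`φ(0) = φ⁰`: each `φ(t)` is (the continuous representative of) a function in `H¹(a, b)`, and
`(∂φ/∂t, ψ) + ν (∇φ, ∇ψ) - (φ, u ∇ψ) = (f, ψ) + g(a) ψ(a) + g(b) ψ(b)` for all `ψ ∈ H¹(a, b)`. -/
structure IsWeakSolution (a b T ν : ℝ) (u f g : ℝ → ℝ → ℝ) (φ₀ : ℝ → ℝ) (φ : ℝ → ℝ → ℝ) :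
    Prop where
  continuousOn : ∀ t ∈ Icc 0 T, ContinuousOn (φ t) (Icc a b)
  weak_form : ∀ t ∈ Ioo 0 T, ∃ p : HSob 1 a b, Represents p (φ t) ∧
    ∀ (q : HSob 1 a b) (ψ : ℝ → ℝ), ContinuousOn ψ (Icc a b) → Represents q ψ →
      (∫ x in Ioo a b, timeDeriv φ t x * ψ x)
        + ν * (∫ x in Ioo a b, p.jet 1 x * q.jet 1 x)
        - (∫ x in Ioo a b, φ t x * (u t x * q.jet 1 x))
      = (∫ x in Ioo a b, f t x * ψ x) + (g t a * ψ a + g t b * ψ b)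
  initial : ∀ᵐ x ∂(volume.restrict (Ioo a b)), φ 0 x = φ₀ x

/-- The number `N_T = ⌊T / Δt⌋` of time steps. -/
def numSteps (T Δt : ℝ) : ℕ := ⌊T / Δt⌋₊

/-- A moving mesh with `Np` points: `a = P n 1 < P n 2 < ⋯ < P n Np = b` for `n = 0, …, N_T`. -/
structure IsMovingMesh (a b : ℝ) (NT Np : ℕ) (P : ℕ → ℕ → ℝ) : Prop where
  two_le : 2 ≤ Np
  left : ∀ n ≤ NT, P n 1 = a
  right : ∀ n ≤ NT, P n Np = b
  lt : ∀ n ≤ NT, ∀ i, 1 ≤ i → i < Np → P n i < P n (i + 1)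

/-- The global mesh size: the largest length of an element `[P n i, P n (i + 1)]`,
`n = 0, …, N_T`, `i = 1, …, Np - 1`. -/
def meshSize (NT Np : ℕ) (P : ℕ → ℕ → ℝ) : ℝ :=
  ⨆ n : Finset.Icc 0 NT, ⨆ i : Finset.Ico 1 Np, (P n (i + 1) - P n i)

/-- The velocity `w_i^n` of the `i`-th mesh point in the `n`-th time step, `n ≥ 1`. -/
def nodeVelocity (Δt : ℝ) (P : ℕ → ℕ → ℝ) (n i : ℕ) : ℝ := (P n i - P (n - 1) i) / Δt

/-- The position `P_i(t)` of the `i`-th mesh point at the time `t` of the `n`-th time step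
`[(n - 1) Δt, n Δt]`, `n ≥ 1`. -/
def nodePos (Δt : ℝ) (P : ℕ → ℕ → ℝ) (n : ℕ) (t : ℝ) (i : ℕ) : ℝ :=
  P (n - 1) i + nodeVelocity Δt P n i * (t - ((n : ℝ) - 1) * Δt)

/-- The P1 basis function `ψ_i` of the mesh `p 1 < ⋯ < p Np`: affine on each `[p j, p (j + 1)]`,
with `ψ_i (p j) = δ_ij`. -/
def hat (Np : ℕ) (p : ℕ → ℝ) (i : ℕ) (x : ℝ) : ℝ :=
  if 1 < i ∧ p (i - 1) ≤ x ∧ x ≤ p i then (x - p (i - 1)) / (p i - p (i - 1))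
  else if i < Np ∧ p i ≤ x ∧ x ≤ p (i + 1) then (p (i + 1) - x) / (p (i + 1) - p i)
  else 0

/-- The Lagrange interpolant `∑ f (p i) ψ_i` of `f` on the mesh `p 1 < ⋯ < p Np`. -/
def interp (Np : ℕ) (p : ℕ → ℝ) (f : ℝ → ℝ) (x : ℝ) : ℝ :=
  ∑ i ∈ Finset.Icc 1 Np, f (p i) * hat Np p i x

/-- The mesh velocity `w(x, t)` at the time `t` of the `n`-th time step: the function that is
affine on each `[P_i(t), P_{i+1}(t)]` with the value `w_i^n` at `P_i(t)`. -/
def meshVelocity (Δt : ℝ) (Np : ℕ) (P : ℕ → ℕ → ℝ) (n : ℕ) (t x : ℝ) : ℝ :=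
  ∑ i ∈ Finset.Icc 1 Np, nodeVelocity Δt P n i * hat Np (nodePos Δt P n t) i x

/-- `‖w‖_{C(L^∞)}`: the supremum over all times of the norm of `w(·, t)` in `L^∞(a, b)`. -/
def velocityNormLinfty (a b Δt : ℝ) (NT Np : ℕ) (P : ℕ → ℕ → ℝ) : ℝ≥0∞ :=
  ⨆ n ∈ Finset.Icc 1 NT, ⨆ t ∈ Icc (((n : ℝ) - 1) * Δt) (n * Δt),
    eLpNorm (meshVelocity Δt Np P n t) ∞ (volume.restrict (Ioo a b))

/-- `‖w‖_{C(W^{1,∞})}`: the supremum over all times of the norm of `w(·, t)` in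
`W^{1,∞}(a, b)`. As `w(·, t)` is piecewise affine and continuous, its weak derivative is its
almost everywhere derivative. -/
def velocityNormW1infty (a b Δt : ℝ) (NT Np : ℕ) (P : ℕ → ℕ → ℝ) : ℝ≥0∞ :=
  ⨆ n ∈ Finset.Icc 1 NT, ⨆ t ∈ Icc (((n : ℝ) - 1) * Δt) (n * Δt),
    max (eLpNorm (meshVelocity Δt Np P n t) ∞ (volume.restrict (Ioo a b)))
      (eLpNorm (deriv (meshVelocity Δt Np P n t)) ∞ (volume.restrict (Ioo a b)))

/-- The function `D̄_Δt (Π_h^n φ^n) - (1 / Δt) ∫_{t^{n-1}}^{t^n} Π_h(t) ∂φ/∂t (·, t) dt`. -/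
def interpError (Δt : ℝ) (Np : ℕ) (P : ℕ → ℕ → ℝ) (φ : ℝ → ℝ → ℝ) (n : ℕ) (x : ℝ) : ℝ :=
  (interp Np (P n) (φ (n * Δt)) x - interp Np (P (n - 1)) (φ (((n : ℝ) - 1) * Δt)) x) / Δt
    - (1 / Δt) * ∫ t in (((n : ℝ) - 1) * Δt)..(n * Δt),
        interp Np (nodePos Δt P n t) (timeDeriv φ t) x

end

/-!
At a fixed point `x`, the interpolant `(Π_h(t) φ(t))(x)` is a function of time, differentiable except
at the finitely many times at which a node crosses `x` (if `x` is not a node at the beginning of the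
step). As the basis functions are transported by the mesh velocity `w`, its derivative is
`Π_h(t) ∂ₜφ + R(t)` with the commutator `R(t) = Π_h(t) (w ∂ₓφ) - w ∂ₓ(Π_h(t) φ)`
(`hasDerivAt_affineOn_moving`). Hence the interpolation error is the mean value of `R` over the time
step (`RegularOnStep.interpError_ae_eq`), and it remains to estimate `R` at a fixed time.

On an element `[p, q]` let `e₀`, `e₁` be the values of `∂ₓφ` at `p`, `q` minus the difference quotient
of `φ`, and let `λ₀`, `λ₁` be the barycentric coordinates. Then `R = w₀ e₀ λ₀ + w₁ e₁ λ₁`. Since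
`|eᵢ| ≤ (q - p)^(1/2) ‖∂ₓ²φ‖`, the `L²` norm of `R` is at most `‖w‖ h ‖∂ₓ²φ‖`
(`integral_interpDefect_sq_le`); the Cauchy–Schwarz inequality in time gives the first estimate.
Against a function `v ∈ H¹` one more power of `h` is gained (`abs_integral_affineOn_mul_le`):
`e₀ + e₁` is the error of the trapezoidal rule, `w₁ - w₀` is of the size of the element, and
`λ₁ - λ₀` has mean value `0`. This is integrated in time with the embedding of `H¹(0, T; H³)` into the
bounded functions, whose constant `T^(-1/2) + T^(1/2)` depends on `T` only.

The regularity of `φ` is used through the point evaluations `Sobolev.eval`, which give the values of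
the continuous representatives of an element of `H^m(a, b; Y)` and of its derivatives of order less
than `m` as continuous linear functionals. They rest on the lemma of du Bois-Reymond, serve for
functions of space and for `H³`-valued functions of time alike, and are differentiable in the operator
norm with respect to the point, which is what makes `t ↦ φ(t, P_i(t))` differentiable for
`φ ∈ C¹([0, T]; H²)`.
-/

/-! ### Weak derivatives on an interval -/

section WeakDeriv

variable {Y : Type*} [NormedAddCommGroup Y] [NormedSpace ℝ Y] {a b : ℝ}

theorem integral_Ioo_smul_eq_integral {ζ : ℝ → ℝ} (hζ : tsupport ζ ⊆ Ioo a b) (f : ℝ → Y) :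
    ∫ s in Ioo a b, ζ s • f s = ∫ s, ζ s • f s := by
  refine setIntegral_eq_integral_of_forall_compl_eq_zero fun s hs => ?_
  rw [image_eq_zero_of_notMem_tsupport (fun h => hs (hζ h)), zero_smul]

theorem integrable_test_smul {ζ : ℝ → ℝ} (h1 : Continuous ζ) (h2 : HasCompactSupport ζ)
    {f : ℝ → Y} (hf : Integrable f (volume.restrict (Ioo a b))) :
    Integrable (fun s => ζ s • f s) (volume.restrict (Ioo a b)) := by
  obtain ⟨C, hC⟩ := h2.exists_bound_of_continuous h1
  exact hf.bdd_smul C h1.aestronglyMeasurable (Eventually.of_forall hC)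

variable [CompleteSpace Y]

theorem ae_eq_zero_of_integral_test_smul_eq_zero {f : ℝ → Y}
    (hf : Integrable f (volume.restrict (Ioo a b)))
    (h : ∀ ζ : ℝ → ℝ, ContDiff ℝ ∞ ζ → HasCompactSupport ζ → tsupport ζ ⊆ Ioo a b →
      ∫ s in Ioo a b, ζ s • f s = 0) :
    f =ᵐ[volume.restrict (Ioo a b)] 0 := by
  rw [EventuallyEq, ae_restrict_iff' measurableSet_Ioo]
  refine isOpen_Ioo.ae_eq_zero_of_integral_contDiff_smul_eq_zero ?_ fun ζ h1 h2 h3 => ?_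
  · exact IntegrableOn.locallyIntegrableOn hf
  · rw [← integral_Ioo_smul_eq_integral h3]
    exact h ζ h1 h2 h3

theorem HasWeakDerivOn.ae_unique {f f' g g' : ℝ → Y} (h : HasWeakDerivOn a b f g)
    (h' : HasWeakDerivOn a b f' g') (hff' : f =ᵐ[volume.restrict (Ioo a b)] f')
    (hg : Integrable g (volume.restrict (Ioo a b)))
    (hg' : Integrable g' (volume.restrict (Ioo a b))) :
    g =ᵐ[volume.restrict (Ioo a b)] g' := by
  have : g - g' =ᵐ[volume.restrict (Ioo a b)] 0 := by
    refine ae_eq_zero_of_integral_test_smul_eq_zero (hg.sub hg') fun ζ h1 h2 h3 => ?_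
    have e : ∫ s in Ioo a b, deriv ζ s • f s = ∫ s in Ioo a b, deriv ζ s • f' s :=
      integral_congr_ae (hff'.mono fun s hs => by simp only [hs])
    rw [h ζ h1 h2 h3, h' ζ h1 h2 h3, neg_inj] at e
    simp only [Pi.sub_apply, smul_sub]
    rw [integral_sub (integrable_test_smul h1.continuous h2 hg)
      (integrable_test_smul h1.continuous h2 hg'), e, sub_self]
  exact this.mono fun s hs => sub_eq_zero.1 hs

/-- A compactly supported smooth function with integral `0` is the derivative of a test
function. -/
theorem exists_test_deriv_eq {η : ℝ → ℝ} (h1 : ContDiff ℝ ∞ η) (h2 : HasCompactSupport η)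
    (h3 : tsupport η ⊆ Ioo a b) (h0 : ∫ s, η s = 0) :
    ∃ ζ : ℝ → ℝ, ContDiff ℝ ∞ ζ ∧ HasCompactSupport ζ ∧ tsupport ζ ⊆ Ioo a b ∧
      deriv ζ = η := by
  rcases (tsupport η).eq_empty_or_nonempty with he | hne
  · rw [tsupport_eq_empty_iff] at he
    exact ⟨0, contDiff_const, HasCompactSupport.zero, by simp [tsupport], by
      rw [he]; exact deriv_const' (0 : ℝ)⟩
  have hc : IsCompact (tsupport η) := h2
  set c := sInf (tsupport η)
  set d := sSup (tsupport η)
  have hcm : c ∈ Ioo a b := h3 (hc.sInf_mem hne)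
  have hdm : d ∈ Ioo a b := h3 (hc.sSup_mem hne)
  have hs : tsupport η ⊆ Icc c d := fun x hx =>
    ⟨csInf_le hc.bddBelow hx, le_csSup hc.bddAbove hx⟩
  have hz : ∀ x, x ∉ Icc c d → η x = 0 := fun x hx =>
    image_eq_zero_of_notMem_tsupport fun h => hx (hs h)
  have hder : ∀ x, HasDerivAt (fun x => ∫ s in a..x, η s) (η x) x := fun x =>
    (h1.continuous.integral_hasStrictDerivAt a x).hasDerivAt
  have hde : deriv (fun x => ∫ s in a..x, η s) = η := funext fun x => (hder x).deriv
  have hsup : tsupport (fun x => ∫ s in a..x, η s) ⊆ Icc c d := by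
    refine closure_minimal (fun x hx => ?_) isClosed_Icc
    by_contra hn
    refine hx ?_
    change ∫ s in a..x, η s = 0
    rcases lt_or_ge x c with h | h
    · refine intervalIntegral.integral_zero_ae (ae_of_all _ fun s hs => hz s fun h' => ?_)
      exact absurd hs.2 (not_le.2 ((max_lt hcm.1 h).trans_le h'.1))
    · have hxd : d < x := not_le.1 fun h' => hn ⟨h, h'⟩
      rw [intervalIntegral.integral_of_le (hcm.1.le.trans h), ← h0]
      refine setIntegral_eq_integral_of_forall_compl_eq_zero fun s hs' => hz s fun hs'' => ?_
      exact hs' ⟨hcm.1.trans_le hs''.1, hs''.2.trans hxd.le⟩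
  refine ⟨fun x => ∫ s in a..x, η s, ?_, ?_, ?_, hde⟩
  · rw [contDiff_infty_iff_deriv, hde]
    exact ⟨fun x => (hder x).differentiableAt, h1⟩
  · exact isCompact_Icc.of_isClosed_subset (isClosed_tsupport _) hsup
  · exact hsup.trans (Icc_subset_Ioo hcm.1 hdm.2)

/-- The lemma of du Bois-Reymond: a function whose weak derivative is `0` is constant. -/
theorem exists_ae_eq_const_of_integral_deriv_smul_eq_zero (hab : a < b) {f : ℝ → Y}
    (hf : Integrable f (volume.restrict (Ioo a b)))
    (h : ∀ ζ : ℝ → ℝ, ContDiff ℝ ∞ ζ → HasCompactSupport ζ → tsupport ζ ⊆ Ioo a b →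
      ∫ s in Ioo a b, deriv ζ s • f s = 0) :
    ∃ c : Y, f =ᵐ[volume.restrict (Ioo a b)] fun _ => c := by
  obtain ⟨ρ, hρ1, hρ2, hρ3, hρ4⟩ : ∃ ρ : ℝ → ℝ, ContDiff ℝ ∞ ρ ∧ HasCompactSupport ρ ∧
      tsupport ρ ⊆ Ioo a b ∧ ∫ s, ρ s = 1 := by
    let β : ContDiffBump ((a + b) / 2) :=
      ⟨(b - a) / 8, (b - a) / 4, by linarith, by linarith⟩
    refine ⟨β.normed volume, β.contDiff_normed, β.hasCompactSupport_normed, ?_,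
      β.integral_normed⟩
    rw [β.tsupport_normed_eq, Real.closedBall_eq_Icc]
    refine Icc_subset_Ioo ?_ ?_ <;> simp only [β] <;> linarith
  refine ⟨∫ s in Ioo a b, ρ s • f s, ?_⟩
  set c := ∫ s in Ioo a b, ρ s • f s
  have : (fun s => f s - c) =ᵐ[volume.restrict (Ioo a b)] 0 := by
    refine ae_eq_zero_of_integral_test_smul_eq_zero (hf.sub (integrable_const c))
      fun η h1 h2 h3 => ?_
    have hsupp : tsupport (fun s => η s - (∫ s, η s) * ρ s) ⊆ Ioo a b :=
      (tsupport_sub _ _).trans (union_subset h3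
        ((closure_mono (Function.support_mul_subset_right _ _)).trans hρ3))
    have hint : ∫ s, (η s - (∫ s, η s) * ρ s) = 0 := by
      rw [integral_sub (h1.continuous.integrable_of_hasCompactSupport h2)
        ((hρ1.continuous.integrable_of_hasCompactSupport hρ2).const_mul _),
        integral_const_mul, hρ4, mul_one, sub_self]
    obtain ⟨ζ, z1, z2, z3, z4⟩ := exists_test_deriv_eq
      (h1.sub (contDiff_const.mul hρ1)) (h2.sub hρ2.mul_left) hsupp hint
    have e := h ζ z1 z2 z3
    rw [z4] at e
    simp only [sub_smul, mul_smul, smul_sub] at e ⊢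
    rw [integral_sub (integrable_test_smul h1.continuous h2 hf)
      (g := fun s => (∫ s, η s) • ρ s • f s)
      ((integrable_test_smul hρ1.continuous hρ2 hf).smul (∫ s, η s)), integral_smul] at e
    rw [integral_sub (integrable_test_smul h1.continuous h2 hf)
      (integrable_test_smul h1.continuous h2 (integrable_const c)),
      integral_Ioo_smul_eq_integral h3 (fun _ => c), integral_smul_const]
    exact e
  exact this.mono fun s hs => sub_eq_zero.1 hs

end WeakDeriv

/-! ### Point evaluation on Sobolev spaces -/

section Eval

theorem integrable_Lp_Ioo {Y : Type*} [NormedAddCommGroup Y] {a b : ℝ}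
    (f : Lp Y 2 (volume.restrict (Ioo a b))) :
    Integrable f (volume.restrict (Ioo a b)) :=
  (Lp.memLp f).integrable one_le_two

theorem integral_norm_Lp_le {Y : Type*} [NormedAddCommGroup Y] {a b : ℝ} {S : Set ℝ} (hS : S ⊆ Ioo a b)
    (f : Lp Y 2 (volume.restrict (Ioo a b))) :
    ∫ s in S, ‖f s‖ ≤ √(volume.real S) * ‖f‖ := by
  have hm : MemLp f 2 (volume.restrict S) :=
    (Lp.memLp f).mono_measure (Measure.restrict_mono hS le_rfl)
  have hfin : volume S ≠ ⊤ := ((measure_mono hS).trans_lt (by simp)).ne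
  have h := eLpNorm_le_eLpNorm_mul_rpow_measure_univ (p := 1) (q := 2) one_le_two hm.1
  have h2 : eLpNorm f 2 (volume.restrict S) ≤ eLpNorm f 2 (volume.restrict (Ioo a b)) :=
    eLpNorm_mono_measure _ (Measure.restrict_mono hS le_rfl)
  rw [integral_norm_eq_lintegral_enorm hm.1, ← eLpNorm_one_eq_lintegral_enorm, Lp.norm_def,
    Real.sqrt_eq_rpow, mul_comm, Measure.real, ENNReal.toReal_rpow, ← ENNReal.toReal_mul]
  refine ENNReal.toReal_mono (ENNReal.mul_ne_top (Lp.eLpNorm_ne_top f)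
    (ENNReal.rpow_ne_top_of_nonneg (by norm_num) hfin)) (h.trans ?_)
  rw [Measure.restrict_apply_univ]
  norm_num
  gcongr

theorem norm_integral_smul_Lp_le {Y : Type*} [NormedAddCommGroup Y] [NormedSpace ℝ Y] {a b : ℝ}
    {k : ℝ → ℝ} {M : ℝ} (hM : 0 ≤ M) (hk : ∀ᵐ s ∂(volume.restrict (Ioo a b)), ‖k s‖ ≤ M)
    (f : Lp Y 2 (volume.restrict (Ioo a b))) :
    ‖∫ s in Ioo a b, k s • f s‖ ≤ M * (√(b - a) * ‖f‖) := by
  have h1 : ‖∫ s in Ioo a b, k s • f s‖ ≤ ∫ s in Ioo a b, M * ‖f s‖ := by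
    refine norm_integral_le_of_norm_le ((integrable_Lp_Ioo f).norm.const_mul M) ?_
    filter_upwards [hk] with s hs
    rw [norm_smul]
    gcongr
  refine h1.trans ?_
  rw [integral_const_mul]
  refine mul_le_mul_of_nonneg_left ((integral_norm_Lp_le subset_rfl f).trans ?_) hM
  rw [Real.volume_real_Ioo]
  refine mul_le_mul_of_nonneg_right ?_ (norm_nonneg _)
  rcases le_total (b - a) 0 with h | h
  · rw [max_eq_right h, Real.sqrt_zero]; exact Real.sqrt_nonneg _
  · rw [max_eq_left h]

variable {Y : Type*} [NormedAddCommGroup Y] [NormedSpace ℝ Y] [CompleteSpace Y] {a b : ℝ}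

/-- The kernel `k_x` with `f(x) = (b - a)⁻¹ ∫ f + ∫ k_x f'`: it is `(s - a) / (b - a)` for
`s ≤ x` and `-(b - s) / (b - a)` for `s > x`. -/
noncomputable def evalKernel (a b x s : ℝ) : ℝ := (Iic x).indicator 1 s - (b - s) / (b - a)

theorem measurable_evalKernel_uncurry (a b : ℝ) :
    Measurable fun p : ℝ × ℝ => evalKernel a b p.1 p.2 := by
  unfold evalKernel
  refine Measurable.sub ?_ (by fun_prop)
  have : (fun p : ℝ × ℝ => (Iic p.1).indicator (1 : ℝ → ℝ) p.2) =
      {p : ℝ × ℝ | p.2 ≤ p.1}.indicator 1 := by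
    ext p; simp [indicator]
  rw [this]
  exact measurable_one.indicator (measurableSet_le measurable_snd measurable_fst)

theorem measurable_evalKernel (a b x : ℝ) : Measurable (evalKernel a b x) :=
  (measurable_evalKernel_uncurry a b).comp measurable_prodMk_left

theorem abs_evalKernel_le {s : ℝ} (hs : s ∈ Ioo a b) (x : ℝ) : |evalKernel a b x s| ≤ 1 := by
  have hab : 0 < b - a := by linarith [hs.1, hs.2]
  have h0 : 0 ≤ (b - s) / (b - a) := div_nonneg (by linarith [hs.2]) hab.le
  have h1 : (b - s) / (b - a) ≤ 1 := (div_le_one hab).2 (by linarith [hs.1])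
  unfold evalKernel
  by_cases h : s ≤ x <;> simp [h, abs_le] <;> constructor <;> linarith

theorem ae_abs_evalKernel_le (a b x : ℝ) :
    ∀ᵐ s ∂(volume.restrict (Ioo a b)), ‖evalKernel a b x s‖ ≤ 1 := by
  filter_upwards [ae_restrict_mem measurableSet_Ioo] with s hs using abs_evalKernel_le hs x

theorem memLp_evalKernel (a b x : ℝ) :
    MemLp (evalKernel a b x) 2 (volume.restrict (Ioo a b)) :=
  MemLp.of_bound (measurable_evalKernel a b x).aestronglyMeasurable 1 (ae_abs_evalKernel_le a b x)

/-- The continuous linear map `f ↦ ∫ k f` for a fixed kernel `k ∈ L²(a, b)`. -/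
noncomputable def pairingL (Y : Type*) [NormedAddCommGroup Y] [NormedSpace ℝ Y] [CompleteSpace Y] {a b : ℝ}
    {k : ℝ → ℝ} (hk : MemLp k 2 (volume.restrict (Ioo a b))) :
    Lp Y 2 (volume.restrict (Ioo a b)) →L[ℝ] Y :=
  (ContinuousLinearMap.lsmul ℝ ℝ : ℝ →L[ℝ] Y →L[ℝ] Y).lpPairing
    (volume.restrict (Ioo a b)) 2 2 (hk.toLp k)

theorem pairingL_apply {k : ℝ → ℝ} (hk : MemLp k 2 (volume.restrict (Ioo a b)))
    (f : Lp Y 2 (volume.restrict (Ioo a b))) :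
    pairingL Y hk f = ∫ s in Ioo a b, k s • f s := by
  rw [pairingL, ContinuousLinearMap.lpPairing_eq_integral]
  refine integral_congr_ae ?_
  filter_upwards [hk.coeFn_toLp] with s hs
  simp [hs]

/-- The indefinite integral against `k_x` has weak derivative `g`. -/
theorem hasWeakDerivOn_integral_evalKernel {g : ℝ → Y}
    (hg : Integrable g (volume.restrict (Ioo a b))) :
    HasWeakDerivOn a b (fun x => ∫ s in Ioo a b, evalKernel a b x s • g s) g := by
  intro ζ h1 h2 h3
  have hd : Continuous (deriv ζ) := h1.continuous_deriv (by simp)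
  have hz : Integrable (deriv ζ) (volume.restrict (Ioo a b)) :=
    (hd.integrable_of_hasCompactSupport h2.deriv).restrict
  have hab0 : ∫ x in Ioo a b, deriv ζ x = 0 := by
    rw [setIntegral_eq_integral_of_forall_compl_eq_zero fun s hs => ?_]
    · exact integral_eq_zero_of_hasDerivAt_of_integrable
        (fun x => (h1.differentiable (by simp) x).hasDerivAt)
        (hd.integrable_of_hasCompactSupport h2.deriv)
        (h1.continuous.integrable_of_hasCompactSupport h2)
    · exact image_eq_zero_of_notMem_tsupport fun h => hs (h3 (tsupport_deriv_subset h))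
  have key : ∀ s ∈ Ioo a b, ∫ x in Ioo a b, deriv ζ x * evalKernel a b x s = -ζ s := by
    intro s hs
    have e : ∀ x, deriv ζ x * evalKernel a b x s
        = (Ici s).indicator (deriv ζ) x - deriv ζ x * ((b - s) / (b - a)) := by
      intro x
      by_cases h : s ≤ x
      · simp [evalKernel, h]; ring
      · simp [evalKernel, h]
    simp only [e]
    rw [integral_sub (hz.indicator measurableSet_Ici) (hz.mul_const _), integral_mul_const, hab0,
      integral_indicator measurableSet_Ici, Measure.restrict_restrict measurableSet_Ici,
      inter_comm, zero_mul, sub_zero]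
    have : Ioo a b ∩ Ici s = Ico s b := by
      ext x; simp only [mem_inter_iff, mem_Ioo, mem_Ici, mem_Ico]
      exact ⟨fun h => ⟨h.2, h.1.2⟩, fun h => ⟨⟨hs.1.trans_le h.1, h.2⟩, h.1⟩⟩
    rw [this, integral_Ico_eq_integral_Ioo, ← integral_Ioc_eq_integral_Ioo,
      ← intervalIntegral.integral_of_le hs.2.le,
      intervalIntegral.integral_deriv_eq_sub (fun x _ => h1.differentiable (by simp) x)
        (hd.intervalIntegrable _ _),
      image_eq_zero_of_notMem_tsupport fun h => lt_irrefl b (h3 h).2, zero_sub]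
  have hprod : Integrable (fun p : ℝ × ℝ => (deriv ζ p.1 * evalKernel a b p.1 p.2) • g p.2)
      ((volume.restrict (Ioo a b)).prod (volume.restrict (Ioo a b))) := by
    refine (hz.smul_prod hg).mono ?_ ?_
    · exact ((hd.measurable.comp measurable_fst).mul
        (measurable_evalKernel_uncurry a b)).aestronglyMeasurable.smul hg.1.comp_snd
    · have : ∀ᵐ p : ℝ × ℝ ∂((volume.restrict (Ioo a b)).prod (volume.restrict (Ioo a b))),
          p.2 ∈ Ioo a b :=
        Measure.quasiMeasurePreserving_snd.ae (ae_restrict_mem measurableSet_Ioo)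
      filter_upwards [this] with p hp
      rw [norm_smul, norm_smul, norm_mul]
      gcongr
      exact mul_le_of_le_one_right (norm_nonneg _) (abs_evalKernel_le hp p.1)
  calc ∫ x in Ioo a b, deriv ζ x • ∫ s in Ioo a b, evalKernel a b x s • g s
      = ∫ x in Ioo a b, ∫ s in Ioo a b, (deriv ζ x * evalKernel a b x s) • g s := by
        simp_rw [mul_smul, integral_smul]
    _ = ∫ s in Ioo a b, ∫ x in Ioo a b, (deriv ζ x * evalKernel a b x s) • g s :=
        integral_integral_swap hprod
    _ = ∫ s in Ioo a b, -(ζ s • g s) := by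
        refine setIntegral_congr_fun measurableSet_Ioo fun s hs => ?_
        simp only [integral_smul_const, key s hs, neg_smul]
    _ = _ := integral_neg _

/-- The function `x ↦ ∫ k_x g` has mean value `0`; this normalisation singles it out among the
primitives of `g`. -/
theorem integral_integral_evalKernel {g : ℝ → Y} (hab : a < b)
    (hg : Integrable g (volume.restrict (Ioo a b))) :
    ∫ x in Ioo a b, ∫ s in Ioo a b, evalKernel a b x s • g s = 0 := by
  have hprod : Integrable (fun p : ℝ × ℝ => evalKernel a b p.1 p.2 • g p.2)
      ((volume.restrict (Ioo a b)).prod (volume.restrict (Ioo a b))) := by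
    refine (hg.comp_snd (volume.restrict (Ioo a b))).mono ?_ ?_
    · exact (measurable_evalKernel_uncurry a b).aestronglyMeasurable.smul hg.1.comp_snd
    · have : ∀ᵐ p : ℝ × ℝ ∂((volume.restrict (Ioo a b)).prod (volume.restrict (Ioo a b))),
          p.2 ∈ Ioo a b :=
        Measure.quasiMeasurePreserving_snd.ae (ae_restrict_mem measurableSet_Ioo)
      filter_upwards [this] with p hp
      rw [norm_smul]
      exact mul_le_of_le_one_left (norm_nonneg _) (abs_evalKernel_le hp p.1)
  rw [integral_integral_swap hprod]
  refine setIntegral_eq_zero_of_forall_eq_zero fun s hs => ?_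
  rw [integral_smul_const]
  have e : ∀ x, evalKernel a b x s = (Ici s).indicator 1 x - (b - s) / (b - a) := by
    intro x
    by_cases h : s ≤ x <;> simp [evalKernel, h]
  have : Ioo a b ∩ Ici s = Ico s b := by
    ext x; simp only [mem_inter_iff, mem_Ioo, mem_Ici, mem_Ico]
    exact ⟨fun h => ⟨h.2, h.1.2⟩, fun h => ⟨⟨hs.1.trans_le h.1, h.2⟩, h.1⟩⟩
  simp only [e]
  rw [integral_sub (f := (Ici s).indicator (1 : ℝ → ℝ))
    ((integrable_const (1 : ℝ)).indicator measurableSet_Ici) (integrable_const _)]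
  have h1 : ∫ x in Ioo a b, (Ici s).indicator (1 : ℝ → ℝ) x = b - s := by
    rw [integral_indicator_one measurableSet_Ici, Measure.real,
      Measure.restrict_apply measurableSet_Ici, inter_comm, this, Real.volume_Ico,
      ENNReal.toReal_ofReal (by linarith [hs.2])]
  rw [h1]
  simp only [integral_const, measureReal_restrict_apply_univ, Real.volume_real_Ioo, smul_eq_mul]
  rw [max_eq_left (by linarith), mul_div_cancel₀ _ (by linarith : b - a ≠ 0), sub_self, zero_smul]

/-- The value of (the continuous representative of) the `i`-th derivative of `F ∈ H^m(a, b; Y)`,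
`i < m`, at the point `x`, as a continuous linear functional of `F`. For `x` outside `[a, b]` it is
the value at the nearest endpoint. -/
noncomputable def Sobolev.eval {m : ℕ} (i : Fin m) (x : ℝ) : Sobolev Y m a b →L[ℝ] Y :=
  ((b - a)⁻¹ • pairingL Y (k := fun _ => 1) (memLp_const 1) ∘L PiLp.proj 2 _ i.castSucc
    + pairingL Y (memLp_evalKernel a b x) ∘L PiLp.proj 2 _ i.succ) ∘L
      (sobolevSubmodule Y m a b).subtypeL

variable {m : ℕ}

theorem Sobolev.eval_apply (i : Fin m) (x : ℝ) (F : Sobolev Y m a b) :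
    Sobolev.eval i x F = (b - a)⁻¹ • (∫ s in Ioo a b, F.jet i.castSucc s)
      + ∫ s in Ioo a b, evalKernel a b x s • F.jet i.succ s := by
  simp [Sobolev.eval, pairingL_apply, Sobolev.jet]

theorem Sobolev.integrable_jet (F : Sobolev Y m a b) (i : Fin (m + 1)) :
    Integrable (F.jet i) (volume.restrict (Ioo a b)) :=
  integrable_Lp_Ioo _

theorem Sobolev.memLp_jet (F : Sobolev Y m a b) (i : Fin (m + 1)) :
    MemLp (F.jet i) 2 (volume.restrict (Ioo a b)) :=
  Lp.memLp _

/-- The Sobolev embedding, with a constant that depends on the length of the interval only and not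
on the target space `Y`. -/
theorem Sobolev.norm_eval_le (i : Fin m) (x : ℝ) (F : Sobolev Y m a b) :
    ‖Sobolev.eval i x F‖ ≤ ((√(b - a))⁻¹ + √(b - a)) * ‖F‖ := by
  have hn : ∀ j, ‖(F : L2Jets Y m a b) j‖ ≤ ‖F‖ := fun j => PiLp.norm_apply_le _ j
  rw [Sobolev.eval_apply, add_mul]
  refine (norm_add_le _ _).trans (add_le_add ?_ ?_)
  · have h := norm_integral_smul_Lp_le (k := fun _ => (1 : ℝ)) zero_le_one (by simp)
      ((F : L2Jets Y m a b) i.castSucc)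
    simp only [one_smul, one_mul] at h
    rw [norm_smul]
    rcases le_or_gt (b - a) 0 with hab | hab
    · rw [Real.sqrt_eq_zero_of_nonpos hab] at h ⊢
      have : ‖∫ s in Ioo a b, F.jet i.castSucc s‖ ≤ 0 := by
        rw [zero_mul] at h; exact h
      simp [norm_le_zero_iff.1 this]
    · rw [norm_inv, Real.norm_of_nonneg hab.le]
      calc (b - a)⁻¹ * ‖∫ s in Ioo a b, F.jet i.castSucc s‖
          ≤ (b - a)⁻¹ * (√(b - a) * ‖F‖) := by
            gcongr
            exact h.trans (by gcongr; exact hn _)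
        _ = (√(b - a))⁻¹ * ‖F‖ := by
            have := Real.sqrt_pos.2 hab
            nth_rewrite 1 [← Real.mul_self_sqrt hab.le]
            field_simp
  · have h := norm_integral_smul_Lp_le zero_le_one (ae_abs_evalKernel_le a b x)
      ((F : L2Jets Y m a b) i.succ)
    rw [one_mul] at h
    exact h.trans (by gcongr; exact hn _)

/-- The function `x ↦ Sobolev.eval i x F` is the continuous representative of the `i`-th weak
derivative. -/
theorem Sobolev.jet_ae_eq_eval (hab : a < b) (i : Fin m) (F : Sobolev Y m a b) :
    F.jet i.castSucc =ᵐ[volume.restrict (Ioo a b)] fun x => Sobolev.eval i x F := by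
  set f := F.jet i.castSucc
  set g := F.jet i.succ
  set u : ℝ → Y := fun x => ∫ s in Ioo a b, evalKernel a b x s • g s
  have hf : Integrable f (volume.restrict (Ioo a b)) := F.integrable_jet _
  have hg : Integrable g (volume.restrict (Ioo a b)) := F.integrable_jet _
  have hu : Integrable u (volume.restrict (Ioo a b)) := by
    refine Integrable.of_bound (C := 1 * (√(b - a) * ‖(F : L2Jets Y m a b) i.succ‖)) ?_
      (ae_of_all _ fun x => norm_integral_smul_Lp_le zero_le_one (ae_abs_evalKernel_le a b x) _)
    exact ((measurable_evalKernel_uncurry a b).aestronglyMeasurable.smul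
      hg.1.comp_snd).integral_prod_right'
  have hw := hasWeakDerivOn_integral_evalKernel hg
  obtain ⟨c, hc⟩ := exists_ae_eq_const_of_integral_deriv_smul_eq_zero hab (hf.sub hu)
    fun ζ h1 h2 h3 => by
      have hd : Continuous (deriv ζ) := h1.continuous_deriv (by simp)
      simp only [Pi.sub_apply, smul_sub]
      rw [integral_sub (integrable_test_smul hd h2.deriv hf) (integrable_test_smul hd h2.deriv hu),
        show ∫ s in Ioo a b, deriv ζ s • f s = _ from F.2 i ζ h1 h2 h3, hw ζ h1 h2 h3]
      exact sub_self _
  -- the constant is the mean value of `f`, as `u` has mean value `0`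
  have hmean : (b - a)⁻¹ • ∫ s in Ioo a b, f s = c := by
    have h1 : ∫ s in Ioo a b, (f - u) s = (b - a) • c := by
      rw [integral_congr_ae hc]
      simp [Real.volume_real_Ioo, hab.le]
    have h2 : ∫ s in Ioo a b, u s = 0 := integral_integral_evalKernel hab hg
    rw [integral_sub' hf hu, h2, sub_zero] at h1
    rw [h1, smul_smul, inv_mul_cancel₀ (by linarith), one_smul]
  filter_upwards [hc] with x hx
  rw [Sobolev.eval_apply, hmean, ← hx]
  simp only [Pi.sub_apply, u, g, sub_add_cancel]

theorem Sobolev.eval_sub_eval (i : Fin m) {x y : ℝ} (hxy : x ≤ y) (F : Sobolev Y m a b) :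
    Sobolev.eval i y F - Sobolev.eval i x F = ∫ s in Ioc x y ∩ Ioo a b, F.jet i.succ s := by
  have hi : ∀ z, Integrable (fun s => evalKernel a b z s • F.jet i.succ s)
      (volume.restrict (Ioo a b)) := fun z =>
    (F.integrable_jet i.succ).bdd_smul 1 (measurable_evalKernel a b z).aestronglyMeasurable
      (ae_abs_evalKernel_le a b z)
  rw [Sobolev.eval_apply, Sobolev.eval_apply, add_sub_add_left_eq_sub, ← integral_sub (hi y) (hi x),
    ← Measure.restrict_restrict measurableSet_Ioc, ← integral_indicator measurableSet_Ioc]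
  refine integral_congr_ae (ae_of_all _ fun s => ?_)
  simp only [← sub_smul, evalKernel, sub_sub_sub_cancel_right]
  by_cases h1 : s ≤ x
  · simp [h1, h1.trans hxy]
  · by_cases h2 : s ≤ y <;> simp [h1, h2, lt_of_not_ge h1]

theorem Sobolev.eval_sub_eval_of_mem (i : Fin m) {x y : ℝ} (hax : a ≤ x) (hxy : x ≤ y)
    (hyb : y ≤ b) (F : Sobolev Y m a b) :
    Sobolev.eval i y F - Sobolev.eval i x F = ∫ s in x..y, F.jet i.succ s := by
  rw [Sobolev.eval_sub_eval i hxy, intervalIntegral.integral_of_le hxy,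
    integral_Ioc_eq_integral_Ioo]
  refine setIntegral_congr_set ?_
  have : (Ioo x y : Set ℝ) =ᵐ[volume] Ioc x y := Ioo_ae_eq_Ioc
  have h2 : Ioo x y ∩ Ioo a b = Ioo x y := inter_eq_left.2 (Ioo_subset_Ioo hax hyb)
  rw [← h2]
  exact this.symm.inter (ae_eq_refl (Ioo a b))

theorem Sobolev.norm_eval_sub_eval_le (i : Fin m) (x y : ℝ) (F : Sobolev Y m a b) :
    ‖Sobolev.eval i y F - Sobolev.eval i x F‖ ≤ √|y - x| * ‖F‖ := by
  wlog hxy : x ≤ y generalizing x y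
  · rw [norm_sub_rev, abs_sub_comm]
    exact this y x (le_of_not_ge hxy)
  rw [Sobolev.eval_sub_eval i hxy, abs_of_nonneg (sub_nonneg.2 hxy)]
  refine (norm_integral_le_integral_norm _).trans
    ((integral_norm_Lp_le inter_subset_right _).trans ?_)
  gcongr
  · refine (measureReal_mono inter_subset_left (by simp)).trans ?_
    rw [Real.volume_real_Ioc_of_le hxy]
  · exact PiLp.norm_apply_le _ _

theorem Sobolev.continuous_eval_apply (i : Fin m) (F : Sobolev Y m a b) :
    Continuous fun x => Sobolev.eval i x F := by
  refine continuous_iff_continuousAt.2 fun x => tendsto_iff_norm_sub_tendsto_zero.2 ?_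
  refine squeeze_zero (fun _ => norm_nonneg _)
    (fun y => Sobolev.norm_eval_sub_eval_le i x y F) ?_
  have : Continuous fun y => √|y - x| * ‖F‖ := by fun_prop
  simpa using this.tendsto x

theorem Sobolev.eval_sub_eval_eq_integral_eval (hab : a < b) (i j : Fin m)
    (hij : j.castSucc = i.succ) {x y : ℝ} (hax : a ≤ x) (hxy : x ≤ y) (hyb : y ≤ b)
    (F : Sobolev Y m a b) :
    Sobolev.eval i y F - Sobolev.eval i x F = ∫ s in x..y, Sobolev.eval j s F := by
  rw [Sobolev.eval_sub_eval_of_mem i hax hxy hyb, ← hij]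
  refine intervalIntegral.integral_congr_ae_restrict ?_
  rw [uIoc_of_le hxy, ← restrict_Ioo_eq_restrict_Ioc]
  exact ae_restrict_of_ae_restrict_of_subset (Ioo_subset_Ioo hax hyb)
    (Sobolev.jet_ae_eq_eval hab j F)

/-! ### Representatives -/

/-- The weak derivatives of a function do not depend on the Sobolev space it is considered in. -/
theorem Sobolev.jet_ae_unique {m' : ℕ} (F : Sobolev Y m a b) (G : Sobolev Y m' a b)
    (h0 : F.jet 0 =ᵐ[volume.restrict (Ioo a b)] G.jet 0) (k : ℕ) (h : k < m + 1)
    (h' : k < m' + 1) :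
    F.jet ⟨k, h⟩ =ᵐ[volume.restrict (Ioo a b)] G.jet ⟨k, h'⟩ := by
  induction k with
  | zero => exact h0
  | succ k ih =>
    exact (F.2 ⟨k, by omega⟩).ae_unique (G.2 ⟨k, by omega⟩) (ih (by omega) (by omega))
      (F.integrable_jet _) (G.integrable_jet _)

theorem Represents.eq_eval {F : HSob m a b} {f : ℝ → ℝ} (hab : a < b) (hF : Represents F f)
    (hf : ContinuousOn f (Icc a b)) (i : Fin m) (hi : i.castSucc = 0) {x : ℝ} (hx : x ∈ Icc a b) :
    f x = Sobolev.eval i x F := by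
  refine Measure.eqOn_Icc_of_ae_eq volume hab.ne ?_ hf
    (Sobolev.continuous_eval_apply i F).continuousOn hx
  rw [← restrict_Ioo_eq_restrict_Icc]
  exact hF.symm.trans (hi ▸ Sobolev.jet_ae_eq_eval hab i F)

end Eval

/-! ### Families of functionals depending on a point -/

section Families

variable {X Y : Type*} [NormedAddCommGroup X] [NormedSpace ℝ X] [NormedAddCommGroup Y]
  [NormedSpace ℝ Y] {a b : ℝ} {E E' : ℝ → X →L[ℝ] Y}

theorem continuous_of_norm_apply_sub_le (h : ∀ x y F, ‖E y F - E x F‖ ≤ √|y - x| * ‖F‖) :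
    Continuous E := by
  refine continuous_iff_continuousAt.2 fun x => tendsto_iff_norm_sub_tendsto_zero.2 ?_
  refine squeeze_zero (fun _ => norm_nonneg _) (fun y => ContinuousLinearMap.opNorm_le_bound _
    (Real.sqrt_nonneg |y - x|) fun F => h x y F) ?_
  have : Continuous fun y => √|y - x| := by fun_prop
  simpa using this.tendsto x

/-- If `E'_x` is the derivative of `E_x` in `x` when applied to any fixed vector, in the integrated
form, then it is the derivative in the operator norm. -/
theorem hasDerivWithinAt_of_apply_sub_eq_integral [CompleteSpace Y] (hE' : Continuous E')
    (h : ∀ y ∈ Icc a b, ∀ F, E y F - E a F = ∫ s in a..y, E' s F) {x : ℝ} (hx : x ∈ Icc a b) :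
    HasDerivWithinAt E (E' x) (Icc a b) x := by
  have e : ∀ y ∈ Icc a b, E y = E a + ∫ s in a..y, E' s := by
    intro y hy
    rw [← sub_eq_iff_eq_add']
    ext F
    rw [ContinuousLinearMap.intervalIntegral_apply (hE'.intervalIntegrable _ _), ← h y hy F]
    rfl
  refine HasDerivWithinAt.congr ?_ e (e x hx)
  exact ((hE'.integral_hasStrictDerivAt a x).hasDerivAt.const_add _).hasDerivWithinAt

end Families

/-! ### Piecewise affine functions on a mesh -/

section Mesh

variable {Np : ℕ} {p : ℕ → ℝ}

theorem mesh_lt_succ (hp : StrictMonoOn p (Icc 1 Np)) {j : ℕ} (h1 : 1 ≤ j) (h2 : j < Np) :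
    p j < p (j + 1) :=
  hp ⟨h1, h2.le⟩ ⟨by omega, h2⟩ (Nat.lt_succ_self j)

theorem mesh_mem_Icc (hp : StrictMonoOn p (Icc 1 Np)) {i : ℕ} (h1 : 1 ≤ i) (h2 : i ≤ Np) :
    p i ∈ Icc (p 1) (p Np) :=
  ⟨hp.monotoneOn ⟨le_rfl, h1.trans h2⟩ ⟨h1, h2⟩ h1,
    hp.monotoneOn ⟨h1, h2⟩ ⟨h1.trans h2, le_rfl⟩ h2⟩

theorem exists_mem_Ico_mesh {n : ℕ} (hn : 1 ≤ n) {x : ℝ} (hx : x ∈ Ico (p 1) (p n)) :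
    ∃ j, 1 ≤ j ∧ j < n ∧ x ∈ Ico (p j) (p (j + 1)) := by
  induction n, hn using Nat.le_induction with
  | base => exact absurd hx.2 (not_lt.2 hx.1)
  | succ n hn ih =>
    rcases lt_or_ge x (p n) with h | h
    · obtain ⟨j, h1, h2, h3⟩ := ih ⟨hx.1, h⟩
      exact ⟨j, h1, by omega, h3⟩
    · exact ⟨n, hn, by omega, h, hx.2⟩

theorem exists_mem_Ioo_mesh (hNp : 1 ≤ Np) {x : ℝ} (hx : x ∈ Ico (p 1) (p Np))
    (hn : ∀ i, 1 ≤ i → i ≤ Np → x ≠ p i) : ∃ j, 1 ≤ j ∧ j < Np ∧ x ∈ Ioo (p j) (p (j + 1)) := by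
  obtain ⟨j, h1, h2, h3⟩ := exists_mem_Ico_mesh hNp hx
  exact ⟨j, h1, h2, lt_of_le_of_ne h3.1 (hn j h1 h2.le).symm, h3.2⟩

theorem hat_left (hp : StrictMonoOn p (Icc 1 Np)) {j : ℕ} (h1 : 1 ≤ j) (h2 : j < Np) {x : ℝ}
    (hx : x ∈ Icc (p j) (p (j + 1))) :
    hat Np p j x = (p (j + 1) - x) / (p (j + 1) - p j) := by
  have hH := sub_pos.2 (mesh_lt_succ hp h1 h2)
  unfold hat
  split_ifs with h h'
  · -- only `x = p j` belongs to the two neighbouring elements, and there both formulas give `1`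
    obtain rfl : x = p j := le_antisymm h.2.2 hx.1
    have h3 : p (j - 1) < p j := hp ⟨by omega, by omega⟩ ⟨h1, h2.le⟩ (by omega)
    rw [div_self (by linarith), div_self hH.ne']
  · rfl
  · exact absurd ⟨h2, hx.1, hx.2⟩ h'

theorem hat_right {j : ℕ} (h1 : 1 ≤ j) {x : ℝ} (hx : x ∈ Icc (p j) (p (j + 1))) :
    hat Np p (j + 1) x = (x - p j) / (p (j + 1) - p j) := by
  unfold hat
  rw [if_pos ⟨by omega, by simpa using hx⟩, Nat.add_sub_cancel]

theorem hat_eq_zero (hp : StrictMonoOn p (Icc 1 Np)) {i j : ℕ} (h1 : 1 ≤ j) (h2 : j < Np)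
    (hi : 1 ≤ i) (hi' : i ≤ Np) (hij : i ≠ j) (hij' : i ≠ j + 1) {x : ℝ}
    (hx : x ∈ Icc (p j) (p (j + 1))) : hat Np p i x = 0 := by
  have hm := hp.monotoneOn
  unfold hat
  split_ifs with h h'
  · rcases lt_or_gt_of_ne hij with hl | hl
    · have : p i < p j := hp ⟨hi, hi'⟩ ⟨h1, h2.le⟩ hl
      linarith [h.2.2, hx.1]
    · have : p (j + 1) ≤ p (i - 1) := hm ⟨by omega, by omega⟩ ⟨by omega, by omega⟩ (by omega)
      rw [show x = p (i - 1) by linarith [h.2.1, hx.2], sub_self, zero_div]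
  · rcases lt_or_gt_of_ne hij with hl | hl
    · have : p (i + 1) ≤ p j := hm ⟨by omega, by omega⟩ ⟨by omega, by omega⟩ (by omega)
      rw [show x = p (i + 1) by linarith [h'.2.2, hx.1], sub_self, zero_div]
    · have : p (j + 1) < p i := hp ⟨by omega, by omega⟩ ⟨hi, hi'⟩ (by omega)
      linarith [h'.2.1, hx.2]
  · rfl

/-- On the element `[p j, p (j + 1)]`, the continuous piecewise affine function with the nodal
values `g i` is the affine interpolant of `g j` and `g (j + 1)`. -/
theorem sum_mul_hat (hp : StrictMonoOn p (Icc 1 Np)) {j : ℕ} (h1 : 1 ≤ j) (h2 : j < Np) {x : ℝ}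
    (hx : x ∈ Icc (p j) (p (j + 1))) (g : ℕ → ℝ) :
    ∑ i ∈ Finset.Icc 1 Np, g i * hat Np p i x =
      g j * ((p (j + 1) - x) / (p (j + 1) - p j))
        + g (j + 1) * ((x - p j) / (p (j + 1) - p j)) := by
  rw [← hat_left hp h1 h2 hx, ← hat_right (Np := Np) h1 hx]
  have hne : j ≠ j + 1 := by omega
  rw [← Finset.sum_pair (f := fun i => g i * hat Np p i x) hne]
  symm
  refine Finset.sum_subset ?_ fun i hi hi' => ?_
  · intro i hi
    simp only [Finset.mem_insert, Finset.mem_singleton] at hi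
    rw [Finset.mem_Icc]; omega
  · rw [Finset.mem_Icc] at hi
    simp only [Finset.mem_insert, Finset.mem_singleton, not_or] at hi'
    rw [hat_eq_zero hp h1 h2 hi.1 hi.2 hi'.1 hi'.2 hx, mul_zero]

theorem exists_mem_Icc_mesh (hNp : 2 ≤ Np) {x : ℝ} (hx : x ∈ Icc (p 1) (p Np)) :
    ∃ j, 1 ≤ j ∧ j < Np ∧ x ∈ Icc (p j) (p (j + 1)) := by
  rcases eq_or_lt_of_le hx.2 with h | h
  · by_cases hl : p (Np - 1) ≤ x
    · exact ⟨Np - 1, by omega, by omega, hl, by rw [Nat.sub_add_cancel (by omega)]; exact hx.2⟩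
    · obtain ⟨j, h1, h2, h3⟩ := exists_mem_Ico_mesh (n := Np - 1) (by omega) ⟨hx.1, not_le.1 hl⟩
      exact ⟨j, h1, by omega, Ico_subset_Icc_self h3⟩
  · obtain ⟨j, h1, h2, h3⟩ := exists_mem_Ico_mesh (by omega) ⟨hx.1, h⟩
    exact ⟨j, h1, h2, Ico_subset_Icc_self h3⟩

/-- A formula for the basis functions without case distinctions in `x`. -/
theorem hat_eq_max_min (hp : StrictMonoOn p (Icc 1 Np)) (hNp : 2 ≤ Np) {i : ℕ} (hi : 1 ≤ i)
    (hi' : i ≤ Np) {x : ℝ} (hx : x ∈ Icc (p 1) (p Np)) :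
    hat Np p i x = max 0 (min (if 1 < i then (x - p (i - 1)) / (p i - p (i - 1)) else 1)
      (if i < Np then (p (i + 1) - x) / (p (i + 1) - p i) else 1)) := by
  have hm := hp.monotoneOn
  have hL : 1 < i → p (i - 1) < p i := fun h => hp ⟨by omega, by omega⟩ ⟨hi, hi'⟩ (by omega)
  have hR : i < Np → p i < p (i + 1) := fun h => mesh_lt_succ hp hi h
  obtain ⟨j, h1, h2, hj⟩ := exists_mem_Icc_mesh hNp hx
  rcases lt_trichotomy i j with hij | rfl | hij
  · rw [hat_eq_zero hp h1 h2 hi hi' (by omega) (by omega) hj, max_eq_left]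
    refine (min_le_right _ _).trans ?_
    have h3 : p (i + 1) ≤ p j := hm ⟨by omega, by omega⟩ ⟨by omega, by omega⟩ (by omega)
    rw [if_pos (by omega)]
    exact div_nonpos_of_nonpos_of_nonneg (by linarith [hj.1]) (by linarith [hR (by omega)])
  · have h4 := hR h2
    have h5 : (p (i + 1) - x) / (p (i + 1) - p i) ≤ 1 := by
      rw [div_le_one (by linarith)]; linarith [hj.1]
    rw [hat_left hp h1 h2 hj, if_pos h2, min_eq_right, max_eq_right]
    · exact div_nonneg (by linarith [hj.2]) (by linarith)
    · refine h5.trans ?_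
      split_ifs with h
      · rw [one_le_div (by linarith [hL h])]; linarith [hj.1]
      · exact le_rfl
  · rcases eq_or_lt_of_le (Nat.succ_le_of_lt hij) with rfl | hij'
    · have h4 := mesh_lt_succ hp h1 h2
      have h5 : (x - p j) / (p (j + 1) - p j) ≤ 1 := by
        rw [div_le_one (by linarith)]; linarith [hj.2]
      rw [hat_right h1 hj, if_pos (by omega), Nat.succ_sub_one, min_eq_left, max_eq_right]
      · exact div_nonneg (by linarith [hj.1]) (by linarith)
      · refine h5.trans ?_
        split_ifs with h
        · rw [one_le_div (by linarith [hR h])]; linarith [hj.2]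
        · exact le_rfl
    · rw [hat_eq_zero hp h1 h2 hi hi' (by omega) (by omega) hj, max_eq_left]
      refine (min_le_left _ _).trans ?_
      have h3 : p (j + 1) ≤ p (i - 1) := hm ⟨by omega, by omega⟩ ⟨by omega, by omega⟩ (by omega)
      rw [if_pos (by omega)]
      exact div_nonpos_of_nonpos_of_nonneg (by linarith [hj.2]) (by linarith [hL (by omega)])

theorem hat_mem_Icc (hp : StrictMonoOn p (Icc 1 Np)) (hNp : 2 ≤ Np) {i : ℕ} (hi : 1 ≤ i)
    (hi' : i ≤ Np) {x : ℝ} (hx : x ∈ Icc (p 1) (p Np)) : hat Np p i x ∈ Icc 0 1 := by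
  rw [hat_eq_max_min hp hNp hi hi' hx]
  refine ⟨le_max_left _ _, max_le zero_le_one ?_⟩
  by_cases h : 1 < i
  · by_cases h' : x ≤ p i
    · refine (min_le_left _ _).trans ?_
      have : p (i - 1) < p i := hp ⟨by omega, by omega⟩ ⟨hi, hi'⟩ (by omega)
      rw [if_pos h, div_le_one (by linarith)]; linarith
    · refine (min_le_right _ _).trans ?_
      split_ifs with hN
      · rw [div_le_one (by linarith [mesh_lt_succ hp hi hN])]; linarith [not_le.1 h']
      · exact le_rfl
  · exact (min_le_left _ _).trans (by rw [if_neg h])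

/-- The basis functions of a mesh that depends continuously on a parameter `z` are continuous in
`z` and `x` together. -/
theorem continuousOn_hat {Z : Type*} [TopologicalSpace Z] {S : Set Z} {q : Z → ℕ → ℝ} {X : Z → ℝ}
    (hq : ∀ z ∈ S, StrictMonoOn (q z) (Icc 1 Np)) (hNp : 2 ≤ Np)
    (hqc : ∀ i, ContinuousOn (fun z => q z i) S) (hX : ContinuousOn X S)
    (hXm : ∀ z ∈ S, X z ∈ Icc (q z 1) (q z Np)) {i : ℕ} (hi : 1 ≤ i) (hi' : i ≤ Np) :
    ContinuousOn (fun z => hat Np (q z) i (X z)) S := by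
  refine ContinuousOn.congr ?_ fun z hz => hat_eq_max_min (hq z hz) hNp hi hi' (hXm z hz)
  refine ContinuousOn.sup continuousOn_const (ContinuousOn.inf ?_ ?_)
  · split_ifs with h
    · refine (hX.sub (hqc _)).div ((hqc _).sub (hqc _)) fun z hz => ?_
      have : q z (i - 1) < q z i := hq z hz ⟨by omega, by omega⟩ ⟨hi, hi'⟩ (by omega)
      linarith
    · exact continuousOn_const
  · split_ifs with h
    · refine ((hqc _).sub hX).div ((hqc _).sub (hqc _)) fun z hz => ?_
      linarith [mesh_lt_succ (hq z hz) hi h]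
    · exact continuousOn_const

theorem sum_mul_hat_node (hp : StrictMonoOn p (Icc 1 Np)) (hNp : 2 ≤ Np) {i : ℕ} (hi : 1 ≤ i)
    (hi' : i ≤ Np) (g : ℕ → ℝ) : ∑ k ∈ Finset.Icc 1 Np, g k * hat Np p k (p i) = g i := by
  rcases eq_or_lt_of_le hi' with rfl | h
  · have h1 : 1 ≤ i - 1 := by omega
    have h2 : i - 1 < i := by omega
    have h3 := mesh_lt_succ hp h1 h2
    rw [sum_mul_hat hp h1 h2 (by rw [Nat.sub_add_cancel hi] at h3 ⊢; exact ⟨h3.le, le_rfl⟩)]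
    rw [Nat.sub_add_cancel hi] at h3 ⊢
    rw [sub_self, zero_div, mul_zero, zero_add, div_self (by linarith), mul_one]
  · have h3 := mesh_lt_succ hp hi h
    rw [sum_mul_hat hp hi h ⟨le_rfl, h3.le⟩, sub_self, zero_div, mul_zero, add_zero,
      div_self (by linarith), mul_one]

/-- The slope of a continuous piecewise affine function inside an element. -/
theorem hasDerivAt_sum_mul_hat (hp : StrictMonoOn p (Icc 1 Np)) {j : ℕ} (h1 : 1 ≤ j)
    (h2 : j < Np) {x : ℝ} (hx : x ∈ Ioo (p j) (p (j + 1))) (g : ℕ → ℝ) :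
    HasDerivAt (fun x => ∑ i ∈ Finset.Icc 1 Np, g i * hat Np p i x)
      ((g (j + 1) - g j) / (p (j + 1) - p j)) x := by
  have e : (fun x => ∑ i ∈ Finset.Icc 1 Np, g i * hat Np p i x) =ᶠ[𝓝 x]
      fun x => g j * ((p (j + 1) - x) / (p (j + 1) - p j))
        + g (j + 1) * ((x - p j) / (p (j + 1) - p j)) := by
    filter_upwards [isOpen_Ioo.mem_nhds hx] with y hy
    exact sum_mul_hat hp h1 h2 (Ioo_subset_Icc_self hy) g
  refine HasDerivAt.congr_of_eventuallyEq ?_ e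
  have d1 : HasDerivAt (fun x => g j * ((p (j + 1) - x) / (p (j + 1) - p j)))
      (g j * (-1 / (p (j + 1) - p j))) x :=
    (((hasDerivAt_id x).const_sub _).div_const _).const_mul _
  have d2 : HasDerivAt (fun x => g (j + 1) * ((x - p j) / (p (j + 1) - p j)))
      (g (j + 1) * (1 / (p (j + 1) - p j))) x :=
    (((hasDerivAt_id x).sub_const _).div_const _).const_mul _
  refine (d1.add d2).congr_deriv ?_
  ring

end Mesh

/-! ### The moving mesh and its velocity -/

section MovingMesh

variable {a b Δt : ℝ} {NT Np : ℕ} {P : ℕ → ℕ → ℝ}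

theorem IsMovingMesh.strictMonoOn (hP : IsMovingMesh a b NT Np P) {n : ℕ} (hn : n ≤ NT) :
    StrictMonoOn (P n) (Icc 1 Np) := by
  intro i hi j hj hij
  obtain ⟨k, rfl⟩ := Nat.exists_eq_add_of_lt hij
  clear hij
  induction k with
  | zero => exact hP.lt n hn i hi.1 hj.2
  | succ k ih =>
    exact (ih ⟨by omega, by have := hj.2; omega⟩).trans
      (hP.lt n hn (i + k + 1) (by omega) hj.2)

theorem nodePos_eq (hΔt : 0 < Δt) (n : ℕ) (t : ℝ) (i : ℕ) :
    nodePos Δt P n t i = (1 - (t - ((n : ℝ) - 1) * Δt) / Δt) * P (n - 1) i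
      + (t - ((n : ℝ) - 1) * Δt) / Δt * P n i := by
  unfold nodePos nodeVelocity
  field_simp
  ring

theorem stepFraction_mem (hΔt : 0 < Δt) {n : ℕ} {t : ℝ}
    (ht : t ∈ Icc (((n : ℝ) - 1) * Δt) (n * Δt)) :
    (t - ((n : ℝ) - 1) * Δt) / Δt ∈ Icc (0 : ℝ) 1 := by
  constructor
  · exact div_nonneg (by linarith [ht.1]) hΔt.le
  · rw [div_le_one hΔt]; nlinarith [ht.2]

theorem nodePos_left (hΔt : 0 < Δt) (n i : ℕ) :
    nodePos Δt P n (((n : ℝ) - 1) * Δt) i = P (n - 1) i := by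
  rw [nodePos_eq hΔt]; simp

theorem nodePos_right (hΔt : 0 < Δt) (n i : ℕ) : nodePos Δt P n (n * Δt) i = P n i := by
  rw [nodePos_eq hΔt, show ((n : ℝ) * Δt - ((n : ℝ) - 1) * Δt) / Δt = 1 by field_simp; ring]
  ring

theorem convexComb_lt {θ x y x' y' : ℝ} (hθ : θ ∈ Icc (0 : ℝ) 1) (h : x < y) (h' : x' < y') :
    (1 - θ) * x + θ * x' < (1 - θ) * y + θ * y' := by
  rcases eq_or_lt_of_le hθ.1 with rfl | h0
  · linarith
  · nlinarith [hθ.2]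

theorem nodePos_strictMonoOn (hP : IsMovingMesh a b NT Np P) (hΔt : 0 < Δt) {n : ℕ}
    (hn : n ≤ NT) {t : ℝ} (ht : t ∈ Icc (((n : ℝ) - 1) * Δt) (n * Δt)) :
    StrictMonoOn (nodePos Δt P n t) (Icc 1 Np) := by
  intro i hi j hj hij
  rw [nodePos_eq hΔt, nodePos_eq hΔt]
  exact convexComb_lt (stepFraction_mem hΔt ht) (hP.strictMonoOn (by omega) hi hj hij)
    (hP.strictMonoOn hn hi hj hij)

theorem nodePos_one (hP : IsMovingMesh a b NT Np P) {n : ℕ} (hn : n ≤ NT) (t : ℝ) :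
    nodePos Δt P n t 1 = a := by
  simp [nodePos, nodeVelocity, hP.left n hn, hP.left (n - 1) (by omega)]

theorem nodePos_last (hP : IsMovingMesh a b NT Np P) {n : ℕ} (hn : n ≤ NT) (t : ℝ) :
    nodePos Δt P n t Np = b := by
  simp [nodePos, nodeVelocity, hP.right n hn, hP.right (n - 1) (by omega)]

theorem nodePos_mem_Icc (hP : IsMovingMesh a b NT Np P) (hΔt : 0 < Δt) {n : ℕ}
    (hn : n ≤ NT) {t : ℝ} (ht : t ∈ Icc (((n : ℝ) - 1) * Δt) (n * Δt)) {i : ℕ} (hi : 1 ≤ i)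
    (hi' : i ≤ Np) : nodePos Δt P n t i ∈ Icc a b := by
  have := mesh_mem_Icc (nodePos_strictMonoOn hP hΔt hn ht) hi hi'
  rwa [nodePos_one hP hn, nodePos_last hP hn] at this

theorem sub_le_meshSize {n i : ℕ} (hn : n ≤ NT) (hi : 1 ≤ i) (hi' : i < Np) :
    P n (i + 1) - P n i ≤ meshSize NT Np P := by
  have h1 : P n (i + 1) - P n i ≤ ⨆ i : Finset.Ico 1 Np, (P n (i + 1) - P n i) :=
    le_ciSup (f := fun i : Finset.Ico 1 Np => P n (i + 1) - P n i)
      (Set.finite_range _).bddAbove ⟨i, Finset.mem_Ico.2 ⟨hi, hi'⟩⟩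
  exact h1.trans (le_ciSup (f := fun n : Finset.Icc 0 NT =>
    ⨆ i : Finset.Ico 1 Np, (P n (i + 1) - P n i))
    (Set.finite_range _).bddAbove ⟨n, Finset.mem_Icc.2 ⟨Nat.zero_le _, hn⟩⟩)

theorem IsMovingMesh.meshSize_pos (hP : IsMovingMesh a b NT Np P) : 0 < meshSize NT Np P :=
  (sub_pos.2 (hP.lt 0 (Nat.zero_le _) 1 le_rfl hP.two_le)).trans_le
    (sub_le_meshSize (Nat.zero_le _) le_rfl hP.two_le)

theorem nodePos_sub_le_meshSize (hΔt : 0 < Δt) {n : ℕ}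
    (hn : n ≤ NT) {t : ℝ} (ht : t ∈ Icc (((n : ℝ) - 1) * Δt) (n * Δt)) {i : ℕ} (hi : 1 ≤ i)
    (hi' : i < Np) :
    nodePos Δt P n t (i + 1) - nodePos Δt P n t i ≤ meshSize NT Np P := by
  rw [nodePos_eq hΔt, nodePos_eq hΔt]
  have hθ := stepFraction_mem hΔt ht
  have h1 := sub_le_meshSize (P := P) hn hi hi'
  have h2 := sub_le_meshSize (P := P) (n := n - 1) (NT := NT) (by omega) hi hi'
  have h3 := mul_le_mul_of_nonneg_left h1 hθ.1
  have h4 := mul_le_mul_of_nonneg_left h2 (sub_nonneg.2 hθ.2)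
  linarith

theorem enorm_le_eLpNorm_top (hab : a < b) {f : ℝ → ℝ} (hf : ContinuousOn f (Icc a b)) {x : ℝ}
    (hx : x ∈ Icc a b) : ‖f x‖ₑ ≤ eLpNorm f ⊤ (volume.restrict (Ioo a b)) := by
  have hae : (fun x => max ‖f x‖ₑ (eLpNorm f ⊤ (volume.restrict (Ioo a b))))
      =ᵐ[volume.restrict (Icc a b)] fun _ => eLpNorm f ⊤ (volume.restrict (Ioo a b)) := by
    rw [← restrict_Ioo_eq_restrict_Icc, eLpNorm_exponent_top]
    filter_upwards [ae_le_eLpNormEssSup (f := f) (μ := volume.restrict (Ioo a b))] with y hy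
    exact max_eq_right hy
  have h := Measure.eqOn_Icc_of_ae_eq volume hab.ne hae
    (ContinuousOn.sup hf.enorm continuousOn_const) continuousOn_const hx
  exact max_eq_right_iff.1 h

theorem continuousOn_meshVelocity (hP : IsMovingMesh a b NT Np P) (hΔt : 0 < Δt) {n : ℕ}
    (hn : n ≤ NT) {t : ℝ} (ht : t ∈ Icc (((n : ℝ) - 1) * Δt) (n * Δt)) :
    ContinuousOn (meshVelocity Δt Np P n t) (Icc a b) := by
  refine continuousOn_finsetSum _ fun i hi => continuousOn_const.mul ?_
  rw [Finset.mem_Icc] at hi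
  refine continuousOn_hat (q := fun _ => nodePos Δt P n t) (X := fun x => x)
    (fun _ _ => nodePos_strictMonoOn hP hΔt hn ht) hP.two_le (fun _ => continuousOn_const)
    continuousOn_id (fun x hx => ?_) hi.1 hi.2
  rwa [nodePos_one hP hn, nodePos_last hP hn]

theorem enorm_nodeVelocity_le (hP : IsMovingMesh a b NT Np P) (hΔt : 0 < Δt) (hab : a < b)
    {n : ℕ} (hn1 : 1 ≤ n) (hn : n ≤ NT) {i : ℕ} (hi : 1 ≤ i) (hi' : i ≤ Np) :
    ‖nodeVelocity Δt P n i‖ₑ ≤ velocityNormLinfty a b Δt NT Np P := by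
  have ht : (n : ℝ) * Δt ∈ Icc (((n : ℝ) - 1) * Δt) (n * Δt) := ⟨by nlinarith, le_rfl⟩
  have h := enorm_le_eLpNorm_top hab (continuousOn_meshVelocity hP hΔt hn ht)
    (nodePos_mem_Icc hP hΔt hn ht hi hi')
  rw [meshVelocity, sum_mul_hat_node (nodePos_strictMonoOn hP hΔt hn ht) hP.two_le hi hi'] at h
  refine h.trans ?_
  exact le_iSup₂_of_le n (Finset.mem_Icc.2 ⟨hn1, hn⟩) (le_iSup₂_of_le (n * Δt) ht le_rfl)

theorem velocityNormLinfty_le_velocityNormW1infty :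
    velocityNormLinfty a b Δt NT Np P ≤ velocityNormW1infty a b Δt NT Np P :=
  iSup₂_mono fun _ _ => iSup₂_mono fun _ _ => le_max_left _ _

/-- In the interior of an element, the slope of the mesh velocity is bounded by its `W^{1,∞}`
norm. -/
theorem enorm_slope_nodeVelocity_le (hP : IsMovingMesh a b NT Np P) (hΔt : 0 < Δt)
    {n : ℕ} (hn1 : 1 ≤ n) (hn : n ≤ NT) {t : ℝ} (ht : t ∈ Icc (((n : ℝ) - 1) * Δt) (n * Δt))
    {i : ℕ} (hi : 1 ≤ i) (hi' : i < Np) :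
    ‖(nodeVelocity Δt P n (i + 1) - nodeVelocity Δt P n i)
      / (nodePos Δt P n t (i + 1) - nodePos Δt P n t i)‖ₑ
      ≤ velocityNormW1infty a b Δt NT Np P := by
  have hm := nodePos_strictMonoOn hP hΔt hn ht
  set q := nodePos Δt P n t
  have h : eLpNorm (deriv (meshVelocity Δt Np P n t)) ⊤ (volume.restrict (Ioo a b))
      ≤ velocityNormW1infty a b Δt NT Np P :=
    le_iSup₂_of_le n (Finset.mem_Icc.2 ⟨hn1, hn⟩)
      (le_iSup₂_of_le t ht (le_max_right _ _))
  refine le_trans ?_ h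
  have hsub : Ioo (q i) (q (i + 1)) ⊆ Ioo a b :=
    Ioo_subset_Ioo (nodePos_mem_Icc hP hΔt hn ht hi hi'.le).1
      (nodePos_mem_Icc hP hΔt hn ht (by omega) hi').2
  have hae := ae_restrict_of_ae_restrict_of_subset hsub
    (ae_le_eLpNormEssSup (f := deriv (meshVelocity Δt Np P n t)) (μ := volume.restrict (Ioo a b)))
  have hne : (ae (volume.restrict (Ioo (q i) (q (i + 1))))).NeBot := by
    rw [ae_neBot, Ne, Measure.restrict_eq_zero, Real.volume_Ioo, ENNReal.ofReal_eq_zero, not_le]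
    exact sub_pos.2 (mesh_lt_succ hm hi hi')
  obtain ⟨x, hx, hx'⟩ := (hae.and (ae_restrict_mem measurableSet_Ioo)).exists
  rw [eLpNorm_exponent_top, ← (hasDerivAt_sum_mul_hat hm hi hi' hx' _).deriv]
  exact hx

/-- The supremum is finite although it runs over all times, since the elements do not degenerate
during a step. Hence its real value is not the junk value `0`. -/
theorem velocityNormW1infty_ne_top (hP : IsMovingMesh a b NT Np P) (hΔt : 0 < Δt) :
    velocityNormW1infty a b Δt NT Np P ≠ ⊤ := by
  -- a bound for the inverse element lengths at all times
  set r : ℕ → ℕ → ℝ := fun n i =>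
    |nodeVelocity Δt P n (i + 1) - nodeVelocity Δt P n i|
      * ((P (n - 1) (i + 1) - P (n - 1) i)⁻¹ + (P n (i + 1) - P n i)⁻¹)
  set M : ℝ := (∑ n ∈ Finset.Icc 1 NT, ∑ i ∈ Finset.Icc 1 Np, |nodeVelocity Δt P n i|)
    + ∑ n ∈ Finset.Icc 1 NT, ∑ i ∈ Finset.Ico 1 Np, r n i
  have hlen : ∀ n ≤ NT, ∀ i, 1 ≤ i → i < Np → 0 < P n (i + 1) - P n i := fun n hn i hi hi' =>
    sub_pos.2 (hP.lt n hn i hi hi')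
  have hr : ∀ n ∈ Finset.Icc 1 NT, ∀ i ∈ Finset.Ico 1 Np, 0 ≤ r n i := by
    intro n hn i hi
    rw [Finset.mem_Icc] at hn; rw [Finset.mem_Ico] at hi
    exact mul_nonneg (abs_nonneg _) (add_nonneg
      (inv_nonneg.2 (hlen _ (by omega) i hi.1 hi.2).le)
      (inv_nonneg.2 (hlen _ hn.2 i hi.1 hi.2).le))
  have hM1 : 0 ≤ ∑ n ∈ Finset.Icc 1 NT, ∑ i ∈ Finset.Icc 1 Np, |nodeVelocity Δt P n i| :=
    Finset.sum_nonneg fun _ _ => Finset.sum_nonneg fun _ _ => abs_nonneg _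
  have hM2 : 0 ≤ ∑ n ∈ Finset.Icc 1 NT, ∑ i ∈ Finset.Ico 1 Np, r n i :=
    Finset.sum_nonneg fun n hn => Finset.sum_nonneg fun i hi => hr n hn i hi
  refine ne_top_of_le_ne_top (ENNReal.ofReal_ne_top (r := M)) ?_
  refine iSup₂_le fun n hn => iSup₂_le fun t ht => ?_
  have hn' := Finset.mem_Icc.1 hn
  have hm := nodePos_strictMonoOn hP hΔt hn'.2 ht
  refine max_le ?_ ?_
  · rw [eLpNorm_exponent_top]
    refine eLpNormEssSup_le_of_ae_bound ?_
    filter_upwards [ae_restrict_mem measurableSet_Ioo] with x hx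
    have hx' : x ∈ Icc (nodePos Δt P n t 1) (nodePos Δt P n t Np) := by
      rw [nodePos_one hP hn'.2, nodePos_last hP hn'.2]; exact Ioo_subset_Icc_self hx
    calc ‖meshVelocity Δt Np P n t x‖
        ≤ ∑ i ∈ Finset.Icc 1 Np, |nodeVelocity Δt P n i| := by
          refine norm_sum_le_of_le _ fun i hi => ?_
          rw [Finset.mem_Icc] at hi
          have h := hat_mem_Icc hm hP.two_le hi.1 hi.2 hx'
          rw [norm_mul, Real.norm_eq_abs, Real.norm_of_nonneg h.1]
          exact mul_le_of_le_one_right (abs_nonneg _) h.2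
      _ ≤ ∑ n ∈ Finset.Icc 1 NT, ∑ i ∈ Finset.Icc 1 Np, |nodeVelocity Δt P n i| :=
          Finset.single_le_sum (f := fun n => ∑ i ∈ Finset.Icc 1 Np, |nodeVelocity Δt P n i|)
            (fun _ _ => Finset.sum_nonneg fun _ _ => abs_nonneg _) hn
      _ ≤ M := le_add_of_nonneg_right hM2
  · rw [eLpNorm_exponent_top]
    refine eLpNormEssSup_le_of_ae_bound ?_
    have hnode : ∀ᵐ x ∂(volume.restrict (Ioo a b)),
        x ∉ (Finset.Icc 1 Np).image (nodePos Δt P n t) :=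
      ae_restrict_of_ae (measure_eq_zero_iff_ae_notMem.1
        (((Finset.Icc 1 Np).image (nodePos Δt P n t)).finite_toSet.measure_zero volume))
    filter_upwards [ae_restrict_mem measurableSet_Ioo, hnode] with x hx hx'
    obtain ⟨j, h1, h2, hj⟩ := exists_mem_Ioo_mesh (Np := Np) (p := nodePos Δt P n t)
      (by have := hP.two_le; omega) (x := x)
      (by rw [nodePos_one hP hn'.2, nodePos_last hP hn'.2]; exact ⟨hx.1.le, hx.2⟩)
      fun i hi hi' h => hx' (Finset.mem_image.2 ⟨i, Finset.mem_Icc.2 ⟨hi, hi'⟩, h.symm⟩)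
    have hd : deriv (meshVelocity Δt Np P n t) x = _ := (hasDerivAt_sum_mul_hat hm h1 h2 hj _).deriv
    have hj' : j ∈ Finset.Ico 1 Np := Finset.mem_Ico.2 ⟨h1, h2⟩
    calc ‖deriv (meshVelocity Δt Np P n t) x‖ ≤ r n j := by
          have l1 := hlen (n - 1) (by omega) j h1 h2
          have l2 := hlen n hn'.2 j h1 h2
          have l3 := sub_pos.2 (mesh_lt_succ hm h1 h2)
          rw [hd, norm_div, Real.norm_eq_abs, Real.norm_of_nonneg l3.le, div_eq_mul_inv]
          refine mul_le_mul_of_nonneg_left ?_ (abs_nonneg _)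
          -- the length at time `t` is at least the smaller one of the lengths at the ends
          have hθ := stepFraction_mem hΔt ht
          rw [nodePos_eq hΔt, nodePos_eq hΔt] at l3 ⊢
          set θ := (t - ((n : ℝ) - 1) * Δt) / Δt
          rcases le_total (P (n - 1) (j + 1) - P (n - 1) j) (P n (j + 1) - P n j) with h | h
          · refine le_add_of_le_of_nonneg (inv_anti₀ l1 ?_) (inv_nonneg.2 l2.le)
            nlinarith [hθ.1]
          · refine le_add_of_nonneg_of_le (inv_nonneg.2 l1.le) (inv_anti₀ l2 ?_)
            nlinarith [hθ.2]
      _ ≤ ∑ i ∈ Finset.Ico 1 Np, r n i :=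
          Finset.single_le_sum (f := fun i => r n i) (hr n hn) hj'
      _ ≤ ∑ n ∈ Finset.Icc 1 NT, ∑ i ∈ Finset.Ico 1 Np, r n i :=
          Finset.single_le_sum (f := fun n => ∑ i ∈ Finset.Ico 1 Np, r n i)
            (fun n hn => Finset.sum_nonneg (hr n hn)) hn
      _ ≤ M := le_add_of_nonneg_left hM1

theorem abs_nodeVelocity_le_Linfty (hP : IsMovingMesh a b NT Np P) (hΔt : 0 < Δt) (hab : a < b)
    {n : ℕ} (hn1 : 1 ≤ n) (hn : n ≤ NT) {i : ℕ} (hi : 1 ≤ i) (hi' : i ≤ Np) :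
    |nodeVelocity Δt P n i| ≤ (velocityNormLinfty a b Δt NT Np P).toReal := by
  have h := ENNReal.toReal_mono (ne_top_of_le_ne_top (velocityNormW1infty_ne_top hP hΔt)
    velocityNormLinfty_le_velocityNormW1infty) (enorm_nodeVelocity_le hP hΔt hab hn1 hn hi hi')
  simpa using h

theorem abs_nodeVelocity_le_W1infty (hP : IsMovingMesh a b NT Np P) (hΔt : 0 < Δt) (hab : a < b)
    {n : ℕ} (hn1 : 1 ≤ n) (hn : n ≤ NT) {i : ℕ} (hi : 1 ≤ i) (hi' : i ≤ Np) :
    |nodeVelocity Δt P n i| ≤ (velocityNormW1infty a b Δt NT Np P).toReal :=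
  (abs_nodeVelocity_le_Linfty hP hΔt hab hn1 hn hi hi').trans
    (ENNReal.toReal_mono (velocityNormW1infty_ne_top hP hΔt)
      velocityNormLinfty_le_velocityNormW1infty)

theorem abs_nodeVelocity_sub_le (hP : IsMovingMesh a b NT Np P) (hΔt : 0 < Δt)
    {n : ℕ} (hn1 : 1 ≤ n) (hn : n ≤ NT) {t : ℝ} (ht : t ∈ Icc (((n : ℝ) - 1) * Δt) (n * Δt))
    {i : ℕ} (hi : 1 ≤ i) (hi' : i < Np) :
    |nodeVelocity Δt P n (i + 1) - nodeVelocity Δt P n i|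
      ≤ (velocityNormW1infty a b Δt NT Np P).toReal
        * (nodePos Δt P n t (i + 1) - nodePos Δt P n t i) := by
  have h := ENNReal.toReal_mono (velocityNormW1infty_ne_top hP hΔt)
    (enorm_slope_nodeVelocity_le hP hΔt hn1 hn ht hi hi')
  have hH := sub_pos.2 (mesh_lt_succ (nodePos_strictMonoOn hP hΔt hn ht) hi hi')
  rwa [toReal_enorm, norm_div, Real.norm_of_nonneg hH.le, div_le_iff₀ hH, Real.norm_eq_abs] at h

end MovingMesh

/-! ### Estimates on one element -/

section Element

variable {p q : ℝ}

theorem sq_integral_le (hpq : p ≤ q) {f : ℝ → ℝ} (hf : IntervalIntegrable f volume p q)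
    (hf2 : IntervalIntegrable (fun x => f x ^ 2) volume p q) :
    (∫ x in p..q, f x) ^ 2 ≤ (q - p) * ∫ x in p..q, f x ^ 2 := by
  rcases eq_or_lt_of_le hpq with rfl | h
  · simp
  set I := ∫ x in p..q, f x
  have hH : 0 < q - p := sub_pos.2 h
  set c := I / (q - p)
  have h0 : 0 ≤ ∫ x in p..q, (f x - c) ^ 2 :=
    intervalIntegral.integral_nonneg hpq fun _ _ => sq_nonneg _
  have e : ∀ x, (f x - c) ^ 2 = f x ^ 2 - 2 * c * f x + c ^ 2 := fun x => by ring
  simp only [e] at h0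
  rw [intervalIntegral.integral_add (hf2.sub (hf.const_mul _)) (by simp),
    intervalIntegral.integral_sub hf2 (hf.const_mul _), intervalIntegral.integral_const_mul,
    intervalIntegral.integral_const, smul_eq_mul] at h0
  have hI : I = c * (q - p) := (div_mul_cancel₀ _ hH.ne').symm
  change 0 ≤ _ - 2 * c * I + _ at h0
  nlinarith

theorem integral_abs_le_sqrt (hpq : p ≤ q) {f : ℝ → ℝ} (hf : IntervalIntegrable f volume p q)
    (hf2 : IntervalIntegrable (fun x => f x ^ 2) volume p q) :
    ∫ x in p..q, |f x| ≤ √(q - p) * √(∫ x in p..q, f x ^ 2) := by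
  rw [← Real.sqrt_mul (sub_nonneg.2 hpq)]
  refine Real.le_sqrt_of_sq_le ?_
  have h := sq_integral_le hpq hf.abs (by simpa only [sq_abs] using hf2)
  simpa only [sq_abs] using h

theorem abs_sub_le_of_sub_eq_integral (hpq : p ≤ q) {f f' : ℝ → ℝ}
    (hf : IntervalIntegrable f' volume p q)
    (hf2 : IntervalIntegrable (fun x => f' x ^ 2) volume p q)
    (h : ∀ x y, p ≤ x → x ≤ y → y ≤ q → f y - f x = ∫ s in x..y, f' s) {x y : ℝ}
    (hx : x ∈ Icc p q) (hy : y ∈ Icc p q) :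
    |f y - f x| ≤ √(q - p) * √(∫ s in p..q, f' s ^ 2) := by
  wlog hxy : x ≤ y generalizing x y
  · rw [abs_sub_comm]
    exact this hy hx (le_of_not_ge hxy)
  rw [h x y hx.1 hxy hy.2]
  refine (intervalIntegral.abs_integral_le_integral_abs hxy).trans
    (le_trans ?_ (integral_abs_le_sqrt hpq hf hf2))
  exact intervalIntegral.integral_mono_interval hx.1 hxy hy.2
    (ae_of_all _ fun _ => abs_nonneg _) hf.abs

/-- The difference between a derivative and a difference quotient. -/
theorem abs_sub_slope_le (hpq : p < q) {f₀ f₁ : ℝ → ℝ} {D : ℝ} (hc : ContinuousOn f₁ (Icc p q))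
    (h0 : f₀ q - f₀ p = ∫ s in p..q, f₁ s)
    (hD : ∀ x ∈ Icc p q, ∀ y ∈ Icc p q, |f₁ y - f₁ x| ≤ D) {z : ℝ} (hz : z ∈ Icc p q) :
    |f₁ z - (f₀ q - f₀ p) / (q - p)| ≤ D := by
  have hH : 0 < q - p := sub_pos.2 hpq
  have e : (f₁ z - (f₀ q - f₀ p) / (q - p)) * (q - p) = ∫ s in p..q, (f₁ z - f₁ s) := by
    rw [intervalIntegral.integral_sub (by simp)
      (hc.intervalIntegrable_of_Icc hpq.le), intervalIntegral.integral_const, h0, smul_eq_mul]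
    field_simp
  have h := intervalIntegral.norm_integral_le_of_norm_le_const (a := p) (b := q)
    (f := fun s => f₁ z - f₁ s) (C := D) fun s hs => by
      rw [uIoc_of_le hpq.le] at hs
      exact hD s (Ioc_subset_Icc_self hs) z hz
  rw [← e, Real.norm_eq_abs, abs_mul, abs_of_pos hH] at h
  exact le_of_mul_le_mul_right h hH

/-- The error of the trapezoidal rule. -/
theorem abs_trapezoid_le (hpq : p < q) {f₀ f₁ f₂ : ℝ → ℝ} {D : ℝ}
    (hc1 : ContinuousOn f₁ (Icc p q)) (hc2 : ContinuousOn f₂ (Icc p q))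
    (h0 : f₀ q - f₀ p = ∫ s in p..q, f₁ s)
    (h1 : ∀ x y, p ≤ x → x ≤ y → y ≤ q → f₁ y - f₁ x = ∫ s in x..y, f₂ s)
    (hD : ∀ x ∈ Icc p q, ∀ y ∈ Icc p q, |f₂ y - f₂ x| ≤ D) :
    |(f₁ p - (f₀ q - f₀ p) / (q - p)) + (f₁ q - (f₀ q - f₀ p) / (q - p))|
      ≤ 2 * (D * (q - p)) := by
  have hH : 0 < q - p := sub_pos.2 hpq
  have hp : p ∈ Icc p q := ⟨le_rfl, hpq.le⟩
  have hq : q ∈ Icc p q := ⟨hpq.le, le_rfl⟩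
  have hD0 : 0 ≤ D := (abs_nonneg _).trans (hD p hp p hp)
  -- the rule is exact for the affine function with the slope `f₂ p`, which is subtracted
  set g₁ : ℝ → ℝ := fun x => f₁ x - f₂ p * (x - p)
  set g₀ : ℝ → ℝ := fun x => f₀ x - f₂ p * ((x - p) ^ 2 / 2)
  have hg0 : g₀ q - g₀ p = ∫ s in p..q, g₁ s := by
    have : ∫ s in p..q, f₂ p * (s - p) = f₂ p * ((q - p) ^ 2 / 2) := by
      rw [intervalIntegral.integral_const_mul, intervalIntegral.integral_comp_sub_right (fun s => s),
        integral_id]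
      ring
    rw [intervalIntegral.integral_sub (hc1.intervalIntegrable_of_Icc hpq.le)
      (Continuous.intervalIntegrable (by fun_prop) _ _), ← h0, this]
    simp only [g₀]
    ring
  have hg1 : ∀ x ∈ Icc p q, ∀ y ∈ Icc p q, |g₁ y - g₁ x| ≤ D * (q - p) := by
    intro x hx y hy
    wlog hxy : x ≤ y generalizing x y
    · rw [abs_sub_comm]
      exact this y hy x hx (le_of_not_ge hxy)
    have hi : IntervalIntegrable f₂ volume x y :=
      (hc2.mono (Icc_subset_Icc hx.1 hy.2)).intervalIntegrable_of_Icc hxy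
    have e : g₁ y - g₁ x = ∫ s in x..y, (f₂ s - f₂ p) := by
      rw [intervalIntegral.integral_sub hi (by simp), ← h1 x y hx.1 hxy hy.2,
        intervalIntegral.integral_const, smul_eq_mul]
      simp only [g₁]
      ring
    have h := intervalIntegral.norm_integral_le_of_norm_le_const (a := x) (b := y)
      (f := fun s => f₂ s - f₂ p) (C := D) fun s hs => by
        rw [uIoc_of_le hxy] at hs
        exact hD p hp s ⟨hx.1.trans hs.1.le, hs.2.trans hy.2⟩
    rw [e]
    refine h.trans (mul_le_mul_of_nonneg_left ?_ hD0)
    rw [abs_of_nonneg (by linarith)]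
    linarith [hx.1, hy.2]
  have hgc : ContinuousOn g₁ (Icc p q) := hc1.sub (by fun_prop)
  have a1 := abs_sub_slope_le hpq hgc hg0 hg1 hp
  have a2 := abs_sub_slope_le hpq hgc hg0 hg1 hq
  have e : (f₁ p - (f₀ q - f₀ p) / (q - p)) + (f₁ q - (f₀ q - f₀ p) / (q - p))
      = (g₁ p - (g₀ q - g₀ p) / (q - p)) + (g₁ q - (g₀ q - g₀ p) / (q - p)) := by
    simp only [g₁, g₀]
    field_simp
    ring
  rw [e]
  exact (abs_add_le _ _).trans (by linarith)

/-- The affine function on `[p, q]` with the values `α` at `p` and `β` at `q`. -/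
noncomputable def affineOn (p q α β x : ℝ) : ℝ :=
  α * ((q - x) / (q - p)) + β * ((x - p) / (q - p))

theorem continuous_affineOn (p q α β : ℝ) : Continuous (affineOn p q α β) := by
  unfold affineOn; fun_prop

theorem abs_affineOn_le (hpq : p < q) {α β M : ℝ} (hα : |α| ≤ M) (hβ : |β| ≤ M) {x : ℝ}
    (hx : x ∈ Icc p q) : |affineOn p q α β x| ≤ M := by
  have hH : 0 < q - p := sub_pos.2 hpq
  have l0 : 0 ≤ (q - x) / (q - p) := div_nonneg (sub_nonneg.2 hx.2) hH.le
  have l1 : 0 ≤ (x - p) / (q - p) := div_nonneg (sub_nonneg.2 hx.1) hH.le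
  have e : (q - x) / (q - p) + (x - p) / (q - p) = 1 := by field_simp; ring
  calc |affineOn p q α β x| ≤ |α| * ((q - x) / (q - p)) + |β| * ((x - p) / (q - p)) := by
        refine (abs_add_le _ _).trans ?_
        rw [abs_mul, abs_mul, abs_of_nonneg l0, abs_of_nonneg l1]
    _ ≤ M * ((q - x) / (q - p)) + M * ((x - p) / (q - p)) := by gcongr
    _ = M := by rw [← mul_add, e, mul_one]

theorem integral_affineOn_sq_le (hpq : p < q) {α β W A : ℝ} (hA : 0 ≤ A)
    (hα : |α| ≤ W * (√(q - p) * √A)) (hβ : |β| ≤ W * (√(q - p) * √A)) :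
    ∫ x in p..q, affineOn p q α β x ^ 2 ≤ (W * (q - p)) ^ 2 * A := by
  have hH : 0 < q - p := sub_pos.2 hpq
  have h : ∫ x in p..q, affineOn p q α β x ^ 2 ≤ ∫ _ in p..q, W ^ 2 * ((q - p) * A) := by
    refine intervalIntegral.integral_mono_on hpq.le
      (Continuous.intervalIntegrable ((continuous_affineOn p q α β).pow 2) _ _) (by simp)
      fun x hx => ?_
    have h1 := abs_affineOn_le hpq hα hβ hx
    calc affineOn p q α β x ^ 2 = |affineOn p q α β x| ^ 2 := (sq_abs _).symm
      _ ≤ (W * (√(q - p) * √A)) ^ 2 := by gcongr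
      _ = W ^ 2 * ((q - p) * A) := by
        rw [mul_pow, mul_pow, Real.sq_sqrt hH.le, Real.sq_sqrt hA]
  refine h.trans_eq ?_
  rw [intervalIntegral.integral_const, smul_eq_mul]
  ring

/-- The estimate of `∫ R v` on one element. The function
`R = w₀ e₀ λ₀ + w₁ e₁ λ₁ = w₀ (e₀ + e₁) λ₀ + (w₁ - w₀) e₁ λ₁ + w₀ e₁ (λ₁ - λ₀)`
has a first term of second order by the trapezoidal rule and a second one by the smoothness of `w`;
the third one is of first order only, but `λ₁ - λ₀` has mean value `0`. -/
theorem abs_integral_affineOn_mul_le (hpq : p < q) {w₀ w₁ e₀ e₁ W A₂ A₃ V V' : ℝ}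
    (hW : 0 ≤ W) (hw0 : |w₀| ≤ W) (hw : |w₁ - w₀| ≤ W * (q - p))
    (he1 : |e₁| ≤ √(q - p) * √A₂) (he : |e₀ + e₁| ≤ 2 * (√(q - p) * √A₃ * (q - p)))
    (hA2 : 0 ≤ A₂) (hA3 : 0 ≤ A₃) (hV0 : 0 ≤ V) (hV'0 : 0 ≤ V')
    {v : ℝ → ℝ} (hv : ContinuousOn v (Icc p q)) (hV : ∫ x in p..q, |v x| ≤ √(q - p) * √V)
    (hV' : ∀ x ∈ Icc p q, |v x - v p| ≤ √(q - p) * √V') :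
    |∫ x in p..q, affineOn p q (w₀ * e₀) (w₁ * e₁) x * v x|
      ≤ 4 * W * (q - p) ^ 2 * (√(A₂ + A₃) * √(V + V')) := by
  have hH : 0 < q - p := sub_pos.2 hpq
  set H := q - p with hHdef
  have hHs : √H * √H = H := Real.mul_self_sqrt hH.le
  have iv : IntervalIntegrable v volume p q := hv.intervalIntegrable_of_Icc hpq.le
  have hmul : ∀ {u : ℝ → ℝ}, Continuous u →
      IntervalIntegrable (fun x => u x * v x) volume p q := fun hu =>
    (hu.continuousOn.mul hv).intervalIntegrable_of_Icc hpq.le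
  -- integrals of `v` against functions bounded by `1`
  have hbd : ∀ {u : ℝ → ℝ}, Continuous u → (∀ x ∈ Icc p q, |u x| ≤ 1) →
      |∫ x in p..q, u x * v x| ≤ √H * √V := by
    intro u hu hu1
    refine ((intervalIntegral.abs_integral_le_integral_abs hpq.le).trans ?_).trans hV
    refine intervalIntegral.integral_mono_on hpq.le (hmul hu).abs iv.abs fun x hx => ?_
    rw [abs_mul]
    exact mul_le_of_le_one_left (abs_nonneg _) (hu1 x hx)
  have c0 : Continuous fun x => (q - x) / H := by fun_prop
  have c1 : Continuous fun x => (x - p) / H := by fun_prop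
  have c2 : Continuous fun x => (x - p) / H - (q - x) / H := by fun_prop
  have b0 : ∀ x ∈ Icc p q, 0 ≤ (q - x) / H ∧ (q - x) / H ≤ 1 := fun x hx =>
    ⟨div_nonneg (sub_nonneg.2 hx.2) hH.le, (div_le_one hH).2 (by linarith [hx.1])⟩
  have b1 : ∀ x ∈ Icc p q, 0 ≤ (x - p) / H ∧ (x - p) / H ≤ 1 := fun x hx =>
    ⟨div_nonneg (sub_nonneg.2 hx.1) hH.le, (div_le_one hH).2 (by linarith [hx.2])⟩
  have i0 := hbd c0 fun x hx => abs_le.2 ⟨by linarith [(b0 x hx).1], (b0 x hx).2⟩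
  have i1 := hbd c1 fun x hx => abs_le.2 ⟨by linarith [(b1 x hx).1], (b1 x hx).2⟩
  have i2 : |∫ x in p..q, ((x - p) / H - (q - x) / H) * v x| ≤ √H * √V' * H := by
    have hz : ∫ x in p..q, ((x - p) / H - (q - x) / H) = 0 := by
      have : ∀ x, (x - p) / H - (q - x) / H = (2 * x - (p + q)) / H := fun x => by ring
      simp only [this]
      rw [intervalIntegral.integral_div, intervalIntegral.integral_sub
        (Continuous.intervalIntegrable (by fun_prop) _ _) (by simp),
        intervalIntegral.integral_const_mul, integral_id, intervalIntegral.integral_const,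
        smul_eq_mul]
      ring
    have e : ∫ x in p..q, ((x - p) / H - (q - x) / H) * v x
        = ∫ x in p..q, ((x - p) / H - (q - x) / H) * (v x - v p) := by
      simp only [mul_sub]
      rw [intervalIntegral.integral_sub (hmul c2)
        ((c2.intervalIntegrable _ _).mul_const _), intervalIntegral.integral_mul_const, hz,
        zero_mul, sub_zero]
    rw [e]
    have h := intervalIntegral.norm_integral_le_of_norm_le_const (a := p) (b := q)
      (f := fun x => ((x - p) / H - (q - x) / H) * (v x - v p)) (C := √H * √V') fun x hx => by
        rw [uIoc_of_le hpq.le] at hx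
        have hx' := Ioc_subset_Icc_self hx
        rw [norm_mul]
        refine (mul_le_of_le_one_left (norm_nonneg _) ?_).trans (hV' x hx')
        rw [Real.norm_eq_abs, abs_le]
        constructor <;> linarith [(b0 x hx').1, (b0 x hx').2, (b1 x hx').1, (b1 x hx').2]
    rwa [Real.norm_eq_abs, abs_of_pos (show 0 < q - p from hH)] at h
  have split : ∫ x in p..q, affineOn p q (w₀ * e₀) (w₁ * e₁) x * v x
      = w₀ * (e₀ + e₁) * (∫ x in p..q, (q - x) / H * v x)
        + (w₁ - w₀) * e₁ * (∫ x in p..q, (x - p) / H * v x)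
        + w₀ * e₁ * (∫ x in p..q, ((x - p) / H - (q - x) / H) * v x) := by
    rw [← intervalIntegral.integral_const_mul, ← intervalIntegral.integral_const_mul,
      ← intervalIntegral.integral_const_mul, ← intervalIntegral.integral_add
        ((hmul c0).const_mul _) ((hmul c1).const_mul _), ← intervalIntegral.integral_add
        (((hmul c0).const_mul _).add ((hmul c1).const_mul _)) ((hmul c2).const_mul _)]
    refine intervalIntegral.integral_congr fun x _ => ?_
    simp only [affineOn, ← hHdef]
    ring
  have sA2 : √A₂ ≤ √(A₂ + A₃) := Real.sqrt_le_sqrt (by linarith)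
  have sA3 : √A₃ ≤ √(A₂ + A₃) := Real.sqrt_le_sqrt (by linarith)
  have sV : √V ≤ √(V + V') := Real.sqrt_le_sqrt (by linarith)
  have sV' : √V' ≤ √(V + V') := Real.sqrt_le_sqrt (by linarith)
  set A := √(A₂ + A₃)
  set B := √(V + V')
  have hA : 0 ≤ A := Real.sqrt_nonneg _
  have t0 : |w₀ * (e₀ + e₁) * (∫ x in p..q, (q - x) / H * v x)|
      ≤ W * (2 * (√H * A * H)) * (√H * B) := by
    rw [abs_mul, abs_mul]
    gcongr
    · exact he.trans (by gcongr)
    · exact i0.trans (by gcongr)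
  have t1 : |(w₁ - w₀) * e₁ * (∫ x in p..q, (x - p) / H * v x)|
      ≤ W * H * (√H * A) * (√H * B) := by
    rw [abs_mul, abs_mul]
    gcongr
    · exact he1.trans (by gcongr)
    · exact i1.trans (by gcongr)
  have t2 : |w₀ * e₁ * (∫ x in p..q, ((x - p) / H - (q - x) / H) * v x)|
      ≤ W * (√H * A) * (√H * B * H) := by
    rw [abs_mul, abs_mul]
    gcongr
    · exact he1.trans (by gcongr)
    · exact i2.trans (by gcongr)
  rw [split]
  calc _ ≤ W * (2 * (√H * A * H)) * (√H * B) + W * H * (√H * A) * (√H * B)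
        + W * (√H * A) * (√H * B * H) :=
        (abs_add_three _ _ _).trans (add_le_add (add_le_add t0 t1) t2)
    _ = 4 * W * (√H * √H) * H * (A * B) := by ring
    _ = 4 * W * H ^ 2 * (A * B) := by rw [hHs]; ring

end Element

/-! ### The commutator of interpolation and transport -/

section Defect

variable {Np : ℕ} {p w : ℕ → ℝ}

/-- For `f₁ = f₀'` and the continuous piecewise affine function `w` with the nodal values `w i`,
this is the function `Π_h (w f₀') - w (Π_h f₀)'` in the interior of the elements, and `0` at the
nodes. -/
noncomputable def interpDefect (Np : ℕ) (p w : ℕ → ℝ) (f₀ f₁ : ℝ → ℝ) (x : ℝ) : ℝ :=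
  ∑ j ∈ Finset.Ico 1 Np, (Ioo (p j) (p (j + 1))).indicator
    (affineOn (p j) (p (j + 1))
      (w j * (f₁ (p j) - (f₀ (p (j + 1)) - f₀ (p j)) / (p (j + 1) - p j)))
      (w (j + 1) * (f₁ (p (j + 1)) - (f₀ (p (j + 1)) - f₀ (p j)) / (p (j + 1) - p j)))) x

theorem interpDefect_of_mem (hp : StrictMonoOn p (Icc 1 Np)) {f₀ f₁ : ℝ → ℝ} {j : ℕ}
    (h1 : 1 ≤ j) (h2 : j < Np) {x : ℝ} (hx : x ∈ Ioo (p j) (p (j + 1))) :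
    interpDefect Np p w f₀ f₁ x = affineOn (p j) (p (j + 1))
      (w j * (f₁ (p j) - (f₀ (p (j + 1)) - f₀ (p j)) / (p (j + 1) - p j)))
      (w (j + 1) * (f₁ (p (j + 1)) - (f₀ (p (j + 1)) - f₀ (p j)) / (p (j + 1) - p j))) x := by
  unfold interpDefect
  rw [Finset.sum_eq_single_of_mem j (Finset.mem_Ico.2 ⟨h1, h2⟩), indicator_of_mem hx]
  intro i hi hij
  rw [Finset.mem_Ico] at hi
  refine indicator_of_notMem (fun hx' => ?_) _
  have hm := hp.monotoneOn
  rcases lt_or_gt_of_ne hij with h | h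
  · have : p (i + 1) ≤ p j := hm ⟨by omega, by omega⟩ ⟨h1, h2.le⟩ h
    linarith [hx'.2, hx.1]
  · have : p (j + 1) ≤ p i := hm ⟨by omega, by omega⟩ ⟨hi.1, hi.2.le⟩ h
    linarith [hx'.1, hx.2]

theorem interpDefect_ae_eq (hp : StrictMonoOn p (Icc 1 Np)) (w : ℕ → ℝ) (f₀ f₁ : ℝ → ℝ) {j : ℕ}
    (h1 : 1 ≤ j) (h2 : j < Np) :
    interpDefect Np p w f₀ f₁ =ᵐ[volume.restrict (uIoc (p j) (p (j + 1)))]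
      affineOn (p j) (p (j + 1))
      (w j * (f₁ (p j) - (f₀ (p (j + 1)) - f₀ (p j)) / (p (j + 1) - p j)))
      (w (j + 1) * (f₁ (p (j + 1)) - (f₀ (p (j + 1)) - f₀ (p j)) / (p (j + 1) - p j))) := by
  rw [uIoc_of_le (mesh_lt_succ hp h1 h2).le, ← restrict_Ioo_eq_restrict_Ioc]
  filter_upwards [ae_restrict_mem measurableSet_Ioo] with x hx
  exact interpDefect_of_mem hp h1 h2 hx

theorem memLp_two_intervalIntegrable {a b x y : ℝ} {f : ℝ → ℝ}
    (hf : MemLp f 2 (volume.restrict (Ioo a b))) (hax : a ≤ x) (hxy : x ≤ y) (hyb : y ≤ b) :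
    IntervalIntegrable f volume x y ∧ IntervalIntegrable (fun s => f s ^ 2) volume x y := by
  have h : volume.restrict (Ioc x y) ≤ volume.restrict (Ioo a b) := by
    rw [← restrict_Ioo_eq_restrict_Ioc]
    exact Measure.restrict_mono (Ioo_subset_Ioo hax hyb) le_rfl
  rw [intervalIntegrable_iff_integrableOn_Ioc_of_le hxy,
    intervalIntegrable_iff_integrableOn_Ioc_of_le hxy]
  exact ⟨(hf.integrable one_le_two).mono_measure h, hf.integrable_sq.mono_measure h⟩

theorem sum_integral_mesh (hNp : 1 ≤ Np) {f : ℝ → ℝ}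
    (hf : ∀ j, 1 ≤ j → j < Np → IntervalIntegrable f volume (p j) (p (j + 1))) :
    ∫ x in p 1..p Np, f x = ∑ j ∈ Finset.Ico 1 Np, ∫ x in p j..p (j + 1), f x :=
  (intervalIntegral.sum_integral_adjacent_intervals_Ico hNp fun j hj => hf j hj.1 hj.2).symm

section Estimates

variable {h W : ℝ} {f₀ f₁ f₂ f₃ v v' : ℝ → ℝ}

/-- The commutator is of first order in `L²` if `f₀` has a second derivative `f₂` in `L²`. -/
theorem integral_interpDefect_sq_le (hp : StrictMonoOn p (Icc 1 Np)) (hNp : 1 ≤ Np)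
    (hh : ∀ j, 1 ≤ j → j < Np → p (j + 1) - p j ≤ h) (hW : 0 ≤ W)
    (hw : ∀ i, 1 ≤ i → i ≤ Np → |w i| ≤ W)
    (hc : ContinuousOn f₁ (Icc (p 1) (p Np)))
    (h0 : ∀ x y, p 1 ≤ x → x ≤ y → y ≤ p Np → f₀ y - f₀ x = ∫ s in x..y, f₁ s)
    (h1 : ∀ x y, p 1 ≤ x → x ≤ y → y ≤ p Np → f₁ y - f₁ x = ∫ s in x..y, f₂ s)
    (h2 : MemLp f₂ 2 (volume.restrict (Ioo (p 1) (p Np)))) :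
    ∫ x in p 1..p Np, interpDefect Np p w f₀ f₁ x ^ 2
      ≤ (W * h) ^ 2 * ∫ x in p 1..p Np, f₂ x ^ 2 := by
  have hsq : ∀ j, 1 ≤ j → j < Np →
      (fun x => interpDefect Np p w f₀ f₁ x ^ 2) =ᵐ[volume.restrict (uIoc (p j) (p (j + 1)))]
        fun x => affineOn (p j) (p (j + 1))
        (w j * (f₁ (p j) - (f₀ (p (j + 1)) - f₀ (p j)) / (p (j + 1) - p j)))
        (w (j + 1) * (f₁ (p (j + 1)) - (f₀ (p (j + 1)) - f₀ (p j)) / (p (j + 1) - p j))) x ^ 2 :=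
    fun j hj hj' => (interpDefect_ae_eq hp w f₀ f₁ hj hj').mono fun x hx => by simp only [hx]
  have hi2 : ∀ j, 1 ≤ j → j < Np → IntervalIntegrable (fun x => f₂ x ^ 2) volume
      (p j) (p (j + 1)) := fun j hj hj' =>
    (memLp_two_intervalIntegrable h2 (mesh_mem_Icc hp hj hj'.le).1 (mesh_lt_succ hp hj hj').le
      (mesh_mem_Icc hp (by omega) hj').2).2
  rw [sum_integral_mesh hNp fun j hj hj' =>
    (Continuous.intervalIntegrable ((continuous_affineOn _ _ _ _).pow 2) _ _).congr_ae
      (hsq j hj hj').symm, sum_integral_mesh hNp hi2, Finset.mul_sum]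
  refine Finset.sum_le_sum fun j hj => ?_
  rw [Finset.mem_Ico] at hj
  obtain ⟨hj, hj'⟩ := hj
  have hlt := mesh_lt_succ hp hj hj'
  have hl := (mesh_mem_Icc hp hj hj'.le).1
  have hr := (mesh_mem_Icc hp (by omega) hj' : p (j + 1) ∈ _).2
  rw [intervalIntegral.integral_congr_ae_restrict (hsq j hj hj')]
  have hA : 0 ≤ ∫ x in p j..p (j + 1), f₂ x ^ 2 :=
    intervalIntegral.integral_nonneg hlt.le fun _ _ => sq_nonneg _
  have hslope : ∀ z ∈ Icc (p j) (p (j + 1)),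
      |f₁ z - (f₀ (p (j + 1)) - f₀ (p j)) / (p (j + 1) - p j)|
        ≤ √(p (j + 1) - p j) * √(∫ x in p j..p (j + 1), f₂ x ^ 2) := fun z hz =>
    abs_sub_slope_le hlt (hc.mono (Icc_subset_Icc hl hr)) (h0 _ _ hl hlt.le hr)
      (fun x hx y hy => abs_sub_le_of_sub_eq_integral hlt.le
        (memLp_two_intervalIntegrable h2 hl hlt.le hr).1 (hi2 j hj hj')
        (fun x y hx hxy hy => h1 x y (hl.trans hx) hxy (hy.trans hr)) hx hy) hz
  refine (integral_affineOn_sq_le hlt hA (W := W) ?_ ?_).trans ?_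
  · rw [abs_mul]
    exact mul_le_mul (hw j hj hj'.le) (hslope _ ⟨le_rfl, hlt.le⟩) (abs_nonneg _) hW
  · rw [abs_mul]
    exact mul_le_mul (hw _ (by omega) hj') (hslope _ ⟨hlt.le, le_rfl⟩) (abs_nonneg _) hW
  · have := hh j hj hj'
    have : 0 ≤ p (j + 1) - p j := by linarith
    gcongr

/-- The commutator is of second order when tested against `v ∈ H¹`, if `f₀` has a third derivative
`f₃` in `L²` and the slopes of `w` are bounded. -/
theorem abs_integral_interpDefect_mul_le (hp : StrictMonoOn p (Icc 1 Np)) (hNp : 1 ≤ Np)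
    (hh : ∀ j, 1 ≤ j → j < Np → p (j + 1) - p j ≤ h) (hW : 0 ≤ W)
    (hw : ∀ i, 1 ≤ i → i ≤ Np → |w i| ≤ W)
    (hw' : ∀ j, 1 ≤ j → j < Np → |w (j + 1) - w j| ≤ W * (p (j + 1) - p j))
    (hc1 : ContinuousOn f₁ (Icc (p 1) (p Np))) (hc2 : ContinuousOn f₂ (Icc (p 1) (p Np)))
    (h0 : ∀ x y, p 1 ≤ x → x ≤ y → y ≤ p Np → f₀ y - f₀ x = ∫ s in x..y, f₁ s)
    (h1 : ∀ x y, p 1 ≤ x → x ≤ y → y ≤ p Np → f₁ y - f₁ x = ∫ s in x..y, f₂ s)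
    (h2 : ∀ x y, p 1 ≤ x → x ≤ y → y ≤ p Np → f₂ y - f₂ x = ∫ s in x..y, f₃ s)
    (h3 : MemLp f₃ 2 (volume.restrict (Ioo (p 1) (p Np))))
    (hcv : ContinuousOn v (Icc (p 1) (p Np)))
    (hv : ∀ x y, p 1 ≤ x → x ≤ y → y ≤ p Np → v y - v x = ∫ s in x..y, v' s)
    (hv' : MemLp v' 2 (volume.restrict (Ioo (p 1) (p Np)))) :
    |∫ x in p 1..p Np, interpDefect Np p w f₀ f₁ x * v x|
      ≤ 4 * W * h ^ 2 *
        (√((∫ x in p 1..p Np, f₂ x ^ 2) + ∫ x in p 1..p Np, f₃ x ^ 2)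
          * √((∫ x in p 1..p Np, v x ^ 2) + ∫ x in p 1..p Np, v' x ^ 2)) := by
  have hmul : ∀ j, 1 ≤ j → j < Np →
      (fun x => interpDefect Np p w f₀ f₁ x * v x) =ᵐ[volume.restrict (uIoc (p j) (p (j + 1)))]
        fun x => affineOn (p j) (p (j + 1))
        (w j * (f₁ (p j) - (f₀ (p (j + 1)) - f₀ (p j)) / (p (j + 1) - p j)))
        (w (j + 1) * (f₁ (p (j + 1)) - (f₀ (p (j + 1)) - f₀ (p j)) / (p (j + 1) - p j))) x * v x :=
    fun j hj hj' => (interpDefect_ae_eq hp w f₀ f₁ hj hj').mono fun x hx => by simp only [hx]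
  have hl : ∀ {j}, 1 ≤ j → j < Np → p 1 ≤ p j := fun hj hj' => (mesh_mem_Icc hp hj hj'.le).1
  have hr : ∀ {j}, 1 ≤ j → j < Np → p (j + 1) ≤ p Np := fun hj hj' =>
    (mesh_mem_Icc hp (by omega) hj').2
  have hlt : ∀ {j}, 1 ≤ j → j < Np → p j < p (j + 1) := fun hj hj' => mesh_lt_succ hp hj hj'
  have hcont : ∀ {u : ℝ → ℝ} {j}, ContinuousOn u (Icc (p 1) (p Np)) → 1 ≤ j → j < Np →
      ContinuousOn u (Icc (p j) (p (j + 1))) := fun hu hj hj' =>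
    hu.mono (Icc_subset_Icc (hl hj hj') (hr hj hj'))
  have hii : ∀ {u : ℝ → ℝ} {j}, ContinuousOn u (Icc (p 1) (p Np)) → 1 ≤ j → j < Np →
      IntervalIntegrable u volume (p j) (p (j + 1)) := fun hu hj hj' =>
    (hcont hu hj hj').intervalIntegrable_of_Icc (hlt hj hj').le
  have hi3 : ∀ j, 1 ≤ j → j < Np → IntervalIntegrable (fun x => f₃ x ^ 2) volume
      (p j) (p (j + 1)) := fun j hj hj' =>
    (memLp_two_intervalIntegrable h3 (hl hj hj') (hlt hj hj').le (hr hj hj')).2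
  have hiv' : ∀ j, 1 ≤ j → j < Np → IntervalIntegrable (fun x => v' x ^ 2) volume
      (p j) (p (j + 1)) := fun j hj hj' =>
    (memLp_two_intervalIntegrable hv' (hl hj hj') (hlt hj hj').le (hr hj hj')).2
  have hnn : ∀ {u : ℝ → ℝ} {j}, 1 ≤ j → j < Np → 0 ≤ ∫ x in p j..p (j + 1), u x ^ 2 :=
    fun hj hj' => intervalIntegral.integral_nonneg (hlt hj hj').le fun _ _ => sq_nonneg _
  rw [sum_integral_mesh hNp fun j hj hj' => IntervalIntegrable.congr_ae
      (((continuous_affineOn _ _ _ _).continuousOn.mul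
        (hcont hcv hj hj')).intervalIntegrable_of_Icc (hlt hj hj').le) (hmul j hj hj').symm,
    sum_integral_mesh (p := p) (f := fun x => f₂ x ^ 2) hNp
      fun j hj hj' => hii (hc2.pow 2) hj hj',
    sum_integral_mesh (p := p) (f := fun x => f₃ x ^ 2) hNp hi3,
    sum_integral_mesh (p := p) (f := fun x => v x ^ 2) hNp
      fun j hj hj' => hii (hcv.pow 2) hj hj',
    sum_integral_mesh (p := p) (f := fun x => v' x ^ 2) hNp hiv', ← Finset.sum_add_distrib, ← Finset.sum_add_distrib]
  have key : ∀ j ∈ Finset.Ico 1 Np, |∫ x in p j..p (j + 1), interpDefect Np p w f₀ f₁ x * v x|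
      ≤ 4 * W * h ^ 2 *
        (√((∫ x in p j..p (j + 1), f₂ x ^ 2) + ∫ x in p j..p (j + 1), f₃ x ^ 2)
          * √((∫ x in p j..p (j + 1), v x ^ 2) + ∫ x in p j..p (j + 1), v' x ^ 2)) := by
    intro j hj
    rw [Finset.mem_Ico] at hj
    obtain ⟨hj, hj'⟩ := hj
    have hjl := hl hj hj'
    have hjr := hr hj hj'
    have hjlt := hlt hj hj'
    rw [intervalIntegral.integral_congr_ae_restrict (hmul j hj hj')]
    have m2 : ∀ x ∈ Icc (p j) (p (j + 1)), ∀ y ∈ Icc (p j) (p (j + 1)), |f₁ y - f₁ x|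
        ≤ √(p (j + 1) - p j) * √(∫ x in p j..p (j + 1), f₂ x ^ 2) := fun x hx y hy =>
      abs_sub_le_of_sub_eq_integral hjlt.le (hii hc2 hj hj') (hii (hc2.pow 2) hj hj')
        (fun x y hx hxy hy => h1 x y (hjl.trans hx) hxy (hy.trans hjr)) hx hy
    have m3 : ∀ x ∈ Icc (p j) (p (j + 1)), ∀ y ∈ Icc (p j) (p (j + 1)), |f₂ y - f₂ x|
        ≤ √(p (j + 1) - p j) * √(∫ x in p j..p (j + 1), f₃ x ^ 2) := fun x hx y hy =>
      abs_sub_le_of_sub_eq_integral hjlt.le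
        (memLp_two_intervalIntegrable h3 hjl hjlt.le hjr).1 (hi3 j hj hj')
        (fun x y hx hxy hy => h2 x y (hjl.trans hx) hxy (hy.trans hjr)) hx hy
    have mv : ∀ x ∈ Icc (p j) (p (j + 1)), |v x - v (p j)|
        ≤ √(p (j + 1) - p j) * √(∫ x in p j..p (j + 1), v' x ^ 2) := fun x hx =>
      abs_sub_le_of_sub_eq_integral hjlt.le
        (memLp_two_intervalIntegrable hv' hjl hjlt.le hjr).1 (hiv' j hj hj')
        (fun x y hx hxy hy => hv x y (hjl.trans hx) hxy (hy.trans hjr)) ⟨le_rfl, hjlt.le⟩ hx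
    refine (abs_integral_affineOn_mul_le hjlt hW (hw j hj hj'.le) (hw' j hj hj')
      (abs_sub_slope_le hjlt (hcont hc1 hj hj') (h0 _ _ hjl hjlt.le hjr) m2 ⟨hjlt.le, le_rfl⟩)
      (abs_trapezoid_le hjlt (hcont hc1 hj hj') (hcont hc2 hj hj') (h0 _ _ hjl hjlt.le hjr)
        (fun x y hx hxy hy => h1 x y (hjl.trans hx) hxy (hy.trans hjr)) m3)
      (hnn hj hj') (hnn hj hj') (hnn hj hj') (hnn hj hj') (hcont hcv hj hj')
      (integral_abs_le_sqrt hjlt.le (hii hcv hj hj') (hii (hcv.pow 2) hj hj')) mv).trans ?_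
    have := hh j hj hj'
    have : 0 ≤ p (j + 1) - p j := by linarith
    gcongr
  refine (Finset.abs_sum_le_sum_abs _ _).trans ((Finset.sum_le_sum key).trans ?_)
  rw [← Finset.mul_sum]
  refine mul_le_mul_of_nonneg_left ?_ (by positivity)
  have hs : ∀ j ∈ Finset.Ico 1 Np, ∀ u u' : ℝ → ℝ,
      0 ≤ (∫ x in p j..p (j + 1), u x ^ 2) + ∫ x in p j..p (j + 1), u' x ^ 2 :=
    fun j hj u u' => by
      rw [Finset.mem_Ico] at hj
      exact add_nonneg (hnn hj.1 hj.2) (hnn hj.1 hj.2)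
  refine (Real.sum_mul_le_sqrt_mul_sqrt _ _ _).trans_eq ?_
  rw [Finset.sum_congr rfl fun j hj => Real.sq_sqrt (hs j hj f₂ f₃),
    Finset.sum_congr rfl fun j hj => Real.sq_sqrt (hs j hj v v')]

end Estimates

end Defect

/-! ### The interpolation error as a time integral -/

section Time

theorem hasDerivAt_family_apply {X Y : Type*} [NormedAddCommGroup X] [NormedSpace ℝ X]
    [NormedAddCommGroup Y] [NormedSpace ℝ Y] {a b : ℝ} {E E' : ℝ → X →L[ℝ] Y}
    (hE : ∀ x ∈ Icc a b, HasDerivWithinAt E (E' x) (Icc a b) x) {F : ℝ → X} {F' : X} {p : ℝ → ℝ}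
    {w t : ℝ} (hF : HasDerivAt F F' t) (hp : HasDerivAt p w t)
    (hm : ∀ᶠ s in 𝓝 t, p s ∈ Icc a b) :
    HasDerivAt (fun s => E (p s) (F s)) (E (p t) F' + w • E' (p t) (F t)) t := by
  have h1 := (hE (p t) hm.self_of_nhds).scomp t (s := {s | p s ∈ Icc a b}) hp.hasDerivWithinAt
    fun s hs => hs
  have h2 : HasDerivAt (E ∘ p) (w • E' (p t)) t := h1.hasDerivAt hm
  have h3 := h2.clm_apply hF
  rw [add_comm]
  exact h3

/-- The rate of change in time of an affine function on a moving element at a fixed point: the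
interpolant of the time derivatives, plus the commutator of interpolation and transport. -/
theorem hasDerivAt_affineOn_moving {l r A B : ℝ → ℝ} {wl wr Al Br Dl Dr t x : ℝ}
    (hl : HasDerivAt l wl t) (hr : HasDerivAt r wr t) (hA : HasDerivAt A (Dl + wl * Al) t)
    (hB : HasDerivAt B (Dr + wr * Br) t) (hlr : l t < r t) :
    HasDerivAt (fun s => affineOn (l s) (r s) (A s) (B s) x)
      (affineOn (l t) (r t) Dl Dr x + affineOn (l t) (r t)
        (wl * (Al - (B t - A t) / (r t - l t))) (wr * (Br - (B t - A t) / (r t - l t))) x) t := by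
  have hH : r t - l t ≠ 0 := (sub_pos.2 hlr).ne'
  have h := (hA.mul ((hr.sub_const x).div (hr.sub hl) hH)).add
    (hB.mul ((hl.const_sub x).div (hr.sub hl) hH))
  refine h.congr_deriv ?_
  simp only [affineOn, Pi.sub_apply, Pi.div_apply]
  field_simp
  ring

theorem hasDerivAt_nodePos (Δt : ℝ) (P : ℕ → ℕ → ℝ) (n : ℕ) (t : ℝ) (i : ℕ) :
    HasDerivAt (fun s => nodePos Δt P n s i) (nodeVelocity Δt P n i) t := by
  have := (((hasDerivAt_id t).sub_const (((n : ℝ) - 1) * Δt)).const_mul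
    (nodeVelocity Δt P n i)).const_add (P (n - 1) i)
  simpa [nodePos] using this

theorem continuous_nodePos (Δt : ℝ) (P : ℕ → ℕ → ℝ) (n i : ℕ) :
    Continuous fun s => nodePos Δt P n s i := by
  unfold nodePos; fun_prop

/-- The regularity of `φ` along the moving mesh during the `n`-th time step. Here `D` is the time
derivative and `X` is the space derivative of `φ`. -/
structure RegularOnStep (a b Δt : ℝ) (Np : ℕ) (P : ℕ → ℕ → ℝ) (n : ℕ) (φ D X : ℝ → ℝ → ℝ) :
    Prop where
  timeDeriv_eq : ∀ t ∈ Ioo (((n : ℝ) - 1) * Δt) (n * Δt), ∀ x ∈ Icc a b, timeDeriv φ t x = D t x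
  hasDerivAt : ∀ i, 1 ≤ i → i ≤ Np → ∀ t ∈ Ioo (((n : ℝ) - 1) * Δt) (n * Δt),
    HasDerivAt (fun s => φ s (nodePos Δt P n s i))
      (D t (nodePos Δt P n t i) + nodeVelocity Δt P n i * X t (nodePos Δt P n t i)) t
  continuousOn : ∀ i, 1 ≤ i → i ≤ Np →
    ContinuousOn (fun s => φ s (nodePos Δt P n s i)) (Icc (((n : ℝ) - 1) * Δt) (n * Δt))
  continuousOn_time : ∀ i, 1 ≤ i → i ≤ Np →
    ContinuousOn (fun s => D s (nodePos Δt P n s i)) (Icc (((n : ℝ) - 1) * Δt) (n * Δt))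
  continuousOn_space : ∀ i, 1 ≤ i → i ≤ Np →
    ContinuousOn (fun s => X s (nodePos Δt P n s i)) (Icc (((n : ℝ) - 1) * Δt) (n * Δt))

variable {a b Δt : ℝ} {NT Np : ℕ} {P : ℕ → ℕ → ℝ} {n : ℕ} {φ D X : ℝ → ℝ → ℝ}

/-- The commutator at the time `t` of the `n`-th time step. -/
noncomputable def stepDefect (Δt : ℝ) (Np : ℕ) (P : ℕ → ℕ → ℝ) (n : ℕ) (φ X : ℝ → ℝ → ℝ)
    (t x : ℝ) : ℝ :=
  interpDefect Np (nodePos Δt P n t) (nodeVelocity Δt P n) (φ t) (X t) x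

theorem RegularOnStep.continuousOn_coeff (hR : RegularOnStep a b Δt Np P n φ D X)
    (hP : IsMovingMesh a b NT Np P) (hΔt : 0 < Δt) (hn : n ≤ NT) {i j : ℕ} (hi : 1 ≤ i)
    (hi' : i ≤ Np) (hj : 1 ≤ j) (hj' : j < Np) :
    ContinuousOn (fun t => nodeVelocity Δt P n i * (X t (nodePos Δt P n t i)
      - (φ t (nodePos Δt P n t (j + 1)) - φ t (nodePos Δt P n t j))
        / (nodePos Δt P n t (j + 1) - nodePos Δt P n t j)))
      (Icc (((n : ℝ) - 1) * Δt) (n * Δt)) := by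
  refine continuousOn_const.mul ((hR.continuousOn_space i hi hi').sub
    (((hR.continuousOn (j + 1) (by omega) hj').sub (hR.continuousOn j hj hj'.le)).div
      ((continuous_nodePos _ _ _ _).sub (continuous_nodePos _ _ _ _)).continuousOn
      fun t ht => ?_))
  exact (sub_pos.2 (mesh_lt_succ (nodePos_strictMonoOn hP hΔt hn ht) hj hj')).ne'

theorem RegularOnStep.exists_bound (hR : RegularOnStep a b Δt Np P n φ D X)
    (hP : IsMovingMesh a b NT Np P) (hΔt : 0 < Δt) (hn : n ≤ NT) :
    ∃ M, ∀ t ∈ Icc (((n : ℝ) - 1) * Δt) (n * Δt), ∀ x, ‖stepDefect Δt Np P n φ X t x‖ ≤ M := by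
  set α : ℕ → ℕ → ℝ → ℝ := fun i j t => nodeVelocity Δt P n i * (X t (nodePos Δt P n t i)
    - (φ t (nodePos Δt P n t (j + 1)) - φ t (nodePos Δt P n t j))
      / (nodePos Δt P n t (j + 1) - nodePos Δt P n t j)) with hα
  have hc : ContinuousOn (fun t => ∑ j ∈ Finset.Ico 1 Np, (|α j j t| + |α (j + 1) j t|))
      (Icc (((n : ℝ) - 1) * Δt) (n * Δt)) := by
    refine continuousOn_finsetSum _ fun j hj => ?_
    rw [Finset.mem_Ico] at hj
    exact (hR.continuousOn_coeff hP hΔt hn hj.1 hj.2.le hj.1 hj.2).abs.add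
      (hR.continuousOn_coeff hP hΔt hn (by omega) hj.2 hj.1 hj.2).abs
  obtain ⟨M, hM⟩ := isCompact_Icc.exists_bound_of_continuousOn hc
  refine ⟨M, fun t ht x => le_trans ?_ ((le_abs_self _).trans (hM t ht))⟩
  unfold stepDefect interpDefect
  refine norm_sum_le_of_le _ fun j hj => ?_
  rw [Finset.mem_Ico] at hj
  by_cases hx : x ∈ Ioo (nodePos Δt P n t j) (nodePos Δt P n t (j + 1))
  · rw [indicator_of_mem hx]
    refine abs_affineOn_le (mesh_lt_succ (nodePos_strictMonoOn hP hΔt hn ht) hj.1 hj.2) ?_ ?_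
      (Ioo_subset_Icc_self hx)
    · exact le_add_of_nonneg_right (abs_nonneg _)
    · exact le_add_of_nonneg_left (abs_nonneg _)
  · rw [indicator_of_notMem hx, norm_zero]
    positivity

/-- Measurability in time and space, in a form that covers both the product of the two domains and
a fixed point in space. -/
theorem RegularOnStep.aestronglyMeasurable (hR : RegularOnStep a b Δt Np P n φ D X)
    (hP : IsMovingMesh a b NT Np P) (hΔt : 0 < Δt) (hn : n ≤ NT) {Z : Type*} [MeasurableSpace Z]
    {μ : Measure Z} {τ ξ : Z → ℝ} (hτ : Measurable τ) (hξ : Measurable ξ)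
    (h : ∀ g : ℝ → ℝ, ContinuousOn g (Icc (((n : ℝ) - 1) * Δt) (n * Δt)) →
      AEStronglyMeasurable (fun z => g (τ z)) μ) :
    AEStronglyMeasurable (fun z => stepDefect Δt Np P n φ X (τ z) (ξ z)) μ := by
  unfold stepDefect interpDefect
  refine Finset.aestronglyMeasurable_fun_sum _ fun j hj => ?_
  rw [Finset.mem_Ico] at hj
  have hq : ∀ i, Measurable fun z => nodePos Δt P n (τ z) i := fun i =>
    (continuous_nodePos Δt P n i).measurable.comp hτ
  have hS : MeasurableSet {z | ξ z ∈ Ioo (nodePos Δt P n (τ z) j) (nodePos Δt P n (τ z) (j + 1))} :=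
    (measurableSet_lt (hq j) hξ).inter (measurableSet_lt hξ (hq (j + 1)))
  have hcoeff : ∀ i, 1 ≤ i → i ≤ Np → _ := fun i hi hi' =>
    h _ (hR.continuousOn_coeff hP hΔt hn hi hi' hj.1 hj.2)
  have hf := ((hcoeff j hj.1 hj.2.le).mul
      (((hq (j + 1)).sub hξ).div ((hq (j + 1)).sub (hq j))).aestronglyMeasurable).add
    ((hcoeff (j + 1) (by omega) hj.2).mul
      ((hξ.sub (hq j)).div ((hq (j + 1)).sub (hq j))).aestronglyMeasurable)
  refine (hf.indicator hS).congr (ae_of_all _ fun z => ?_)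
  by_cases hz : ξ z ∈ Ioo (nodePos Δt P n (τ z) j) (nodePos Δt P n (τ z) (j + 1))
  · rw [indicator_of_mem (by exact hz)]
    beta_reduce
    rw [indicator_of_mem hz]
    rfl
  · exact (indicator_of_notMem (M := ℝ) (s := {z | ξ z ∈ Ioo (nodePos Δt P n (τ z) j)
      (nodePos Δt P n (τ z) (j + 1))}) hz _).trans (indicator_of_notMem (M := ℝ) hz _).symm

theorem RegularOnStep.intervalIntegrable (hR : RegularOnStep a b Δt Np P n φ D X)
    (hP : IsMovingMesh a b NT Np P) (hΔt : 0 < Δt) (hn : n ≤ NT) {x : ℝ} (hx : x ∈ Icc a b) :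
    IntervalIntegrable (fun t => interp Np (nodePos Δt P n t) (timeDeriv φ t) x) volume
      (((n : ℝ) - 1) * Δt) (n * Δt) := by
  have hle : ((n : ℝ) - 1) * Δt ≤ n * Δt := by nlinarith
  have hc : ContinuousOn (fun t => interp Np (nodePos Δt P n t) (D t) x)
      (Icc (((n : ℝ) - 1) * Δt) (n * Δt)) := by
    refine continuousOn_finsetSum _ fun i hi => ?_
    rw [Finset.mem_Icc] at hi
    refine (hR.continuousOn_time i hi.1 hi.2).mul (continuousOn_hat
      (fun t ht => nodePos_strictMonoOn hP hΔt hn ht) hP.two_le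
      (fun i => (continuous_nodePos Δt P n i).continuousOn) continuousOn_const
      (fun t _ => ?_) hi.1 hi.2)
    rwa [nodePos_one hP hn, nodePos_last hP hn]
  refine (hc.intervalIntegrable_of_Icc hle).congr_ae ?_
  rw [uIoc_of_le hle, ← restrict_Ioo_eq_restrict_Ioc]
  filter_upwards [ae_restrict_mem measurableSet_Ioo] with t ht
  refine Finset.sum_congr rfl fun i hi => ?_
  rw [Finset.mem_Icc] at hi
  rw [hR.timeDeriv_eq t ht _ (nodePos_mem_Icc hP hΔt hn (Ioo_subset_Icc_self ht) hi.1 hi.2)]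

theorem RegularOnStep.intervalIntegrable_stepDefect (hR : RegularOnStep a b Δt Np P n φ D X)
    (hP : IsMovingMesh a b NT Np P) (hΔt : 0 < Δt) (hn : n ≤ NT) (x : ℝ) :
    IntervalIntegrable (fun t => stepDefect Δt Np P n φ X t x) volume
      (((n : ℝ) - 1) * Δt) (n * Δt) := by
  have hle : ((n : ℝ) - 1) * Δt ≤ n * Δt := by nlinarith
  rw [intervalIntegrable_iff_integrableOn_Ioc_of_le hle]
  obtain ⟨M, hM⟩ := hR.exists_bound hP hΔt hn
  refine Integrable.of_bound (hR.aestronglyMeasurable hP hΔt hn measurable_id measurable_const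
    fun g hg => ?_) M ?_
  · exact (hg.mono Ioc_subset_Icc_self).aestronglyMeasurable measurableSet_Ioc
  · filter_upwards [ae_restrict_mem measurableSet_Ioc] with t ht
    exact hM t (Ioc_subset_Icc_self ht) x

/-- At a point which is not a node at the beginning of the step, the interpolation error is the
mean value of the commutator over the time step. Such a point is crossed by the nodes at finitely
many times only; at the other times the interpolant is differentiable. -/
theorem RegularOnStep.interpError_eq (hR : RegularOnStep a b Δt Np P n φ D X)
    (hP : IsMovingMesh a b NT Np P) (hΔt : 0 < Δt) (hn : n ≤ NT) {x : ℝ} (hx : x ∈ Ioo a b)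
    (hxP : ∀ i, 1 ≤ i → i ≤ Np → x ≠ P (n - 1) i) :
    interpError Δt Np P φ n x =
      (1 / Δt) * ∫ t in (((n : ℝ) - 1) * Δt)..(n * Δt), stepDefect Δt Np P n φ X t x := by
  have hle : ((n : ℝ) - 1) * Δt ≤ n * Δt := by nlinarith
  have hi1 := hR.intervalIntegrable hP hΔt hn (Ioo_subset_Icc_self hx)
  have hi2 := hR.intervalIntegrable_stepDefect hP hΔt hn x
  set S : Set ℝ := ⋃ i ∈ Finset.Icc 1 Np, {t | nodePos Δt P n t i = x}
  have hS : S.Countable := by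
    refine (Finset.countable_toSet _).biUnion fun i hi => Set.Subsingleton.countable ?_
    intro t ht s hs
    rw [Finset.mem_coe, Finset.mem_Icc] at hi
    have h0 : nodeVelocity Δt P n i ≠ 0 := by
      intro h0
      refine hxP i hi.1 hi.2 ?_
      rw [← show nodePos Δt P n t i = x from ht, nodePos, h0, zero_mul, add_zero]
    have h1 : nodePos Δt P n t i = nodePos Δt P n s i :=
      (show nodePos Δt P n t i = x from ht).trans (show nodePos Δt P n s i = x from hs).symm
    simp only [nodePos, add_right_inj, mul_right_inj' h0] at h1
    linarith
  have hc : ContinuousOn (fun t => interp Np (nodePos Δt P n t) (φ t) x)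
      (Icc (((n : ℝ) - 1) * Δt) (n * Δt)) := by
    refine continuousOn_finsetSum _ fun i hi => ?_
    rw [Finset.mem_Icc] at hi
    refine (hR.continuousOn i hi.1 hi.2).mul (continuousOn_hat
      (fun t ht => nodePos_strictMonoOn hP hΔt hn ht) hP.two_le
      (fun i => (continuous_nodePos Δt P n i).continuousOn) continuousOn_const
      (fun t _ => ?_) hi.1 hi.2)
    rw [nodePos_one hP hn, nodePos_last hP hn]
    exact Ioo_subset_Icc_self hx
  have hd : ∀ t ∈ Ioo (((n : ℝ) - 1) * Δt) (n * Δt) \ S,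
      HasDerivAt (fun t => interp Np (nodePos Δt P n t) (φ t) x)
        (interp Np (nodePos Δt P n t) (timeDeriv φ t) x + stepDefect Δt Np P n φ X t x) t := by
    rintro t ⟨ht, htS⟩
    have ht' := Ioo_subset_Icc_self ht
    have hm := nodePos_strictMonoOn hP hΔt hn ht'
    obtain ⟨j, h1, h2, hj⟩ := exists_mem_Ioo_mesh (Np := Np) (p := nodePos Δt P n t)
      (by have := hP.two_le; omega) (x := x)
      (by rw [nodePos_one hP hn, nodePos_last hP hn]; exact ⟨hx.1.le, hx.2⟩)
      fun i hi hi' h => htS (mem_biUnion (Finset.mem_Icc.2 ⟨hi, hi'⟩) h.symm)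
    have he : (fun t => interp Np (nodePos Δt P n t) (φ t) x) =ᶠ[𝓝 t] fun s =>
        affineOn (nodePos Δt P n s j) (nodePos Δt P n s (j + 1))
          (φ s (nodePos Δt P n s j)) (φ s (nodePos Δt P n s (j + 1))) x := by
      filter_upwards [isOpen_Ioo.mem_nhds ht,
        ((continuous_nodePos Δt P n j).tendsto t).eventually_lt_const hj.1,
        ((continuous_nodePos Δt P n (j + 1)).tendsto t).eventually_const_lt hj.2] with s hs hs1 hs2
      exact sum_mul_hat (nodePos_strictMonoOn hP hΔt hn (Ioo_subset_Icc_self hs)) h1 h2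
        ⟨hs1.le, hs2.le⟩ fun i => φ s (nodePos Δt P n s i)
    refine HasDerivAt.congr_of_eventuallyEq ?_ he
    have e1 : interp Np (nodePos Δt P n t) (timeDeriv φ t) x =
        affineOn (nodePos Δt P n t j) (nodePos Δt P n t (j + 1))
          (D t (nodePos Δt P n t j)) (D t (nodePos Δt P n t (j + 1))) x := by
      rw [← hR.timeDeriv_eq t ht _ (nodePos_mem_Icc hP hΔt hn ht' h1 h2.le),
        ← hR.timeDeriv_eq t ht _ (nodePos_mem_Icc hP hΔt hn ht' (by omega) h2)]
      exact sum_mul_hat hm h1 h2 (Ioo_subset_Icc_self hj) fun i => timeDeriv φ t (nodePos Δt P n t i)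
    rw [e1, stepDefect, interpDefect_of_mem hm h1 h2 hj]
    exact hasDerivAt_affineOn_moving (hasDerivAt_nodePos _ _ _ _ _) (hasDerivAt_nodePos _ _ _ _ _)
      (hR.hasDerivAt j h1 h2.le t ht) (hR.hasDerivAt (j + 1) (by omega) h2 t ht)
      (mesh_lt_succ hm h1 h2)
  have key := integral_eq_of_hasDerivAt_off_countable_of_le _ _ hle hS hc hd (hi1.add hi2)
  rw [intervalIntegral.integral_add hi1 hi2] at key
  have eL : nodePos Δt P n (((n : ℝ) - 1) * Δt) = P (n - 1) := funext fun i => nodePos_left hΔt n i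
  have eR : nodePos Δt P n (n * Δt) = P n := funext fun i => nodePos_right hΔt n i
  simp only [eL, eR] at key
  rw [interpError, ← key]
  ring

theorem RegularOnStep.interpError_ae_eq (hR : RegularOnStep a b Δt Np P n φ D X)
    (hP : IsMovingMesh a b NT Np P) (hΔt : 0 < Δt) (hn : n ≤ NT) :
    interpError Δt Np P φ n =ᵐ[volume.restrict (Ioo a b)] fun x =>
      (1 / Δt) * ∫ t in (((n : ℝ) - 1) * Δt)..(n * Δt), stepDefect Δt Np P n φ X t x := by
  have hnode : ∀ᵐ x ∂(volume.restrict (Ioo a b)), x ∉ (Finset.Icc 1 Np).image (P (n - 1)) :=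
    ae_restrict_of_ae (measure_eq_zero_iff_ae_notMem.1
      (((Finset.Icc 1 Np).image (P (n - 1))).finite_toSet.measure_zero volume))
  filter_upwards [ae_restrict_mem measurableSet_Ioo, hnode] with x hx hx'
  exact hR.interpError_eq hP hΔt hn hx fun i hi hi' h =>
    hx' (Finset.mem_image.2 ⟨i, Finset.mem_Icc.2 ⟨hi, hi'⟩, h.symm⟩)

end Time

/-! ### Time averages -/

section Average

variable {t₀ t₁ a b M : ℝ} {R : ℝ → ℝ → ℝ}

theorem memLp_time_average
    (hm : AEStronglyMeasurable (fun z : ℝ × ℝ => R z.1 z.2)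
      ((volume.restrict (Ioc t₀ t₁)).prod (volume.restrict (Ioo a b))))
    (hM : ∀ t ∈ Ioc t₀ t₁, ∀ x, ‖R t x‖ ≤ M) (ht : t₀ ≤ t₁) :
    MemLp (fun x => ∫ t in t₀..t₁, R t x) 2 (volume.restrict (Ioo a b)) := by
  simp only [intervalIntegral.integral_of_le ht]
  refine MemLp.of_bound hm.prod_swap.integral_prod_right' (M * (t₁ - t₀)) (ae_of_all _ fun x => ?_)
  have := norm_setIntegral_le_of_norm_le_const (μ := volume) (s := Ioc t₀ t₁) (f := fun t => R t x)
    (C := M) (by simp) fun t ht => hM t ht x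
  rwa [Real.volume_real_Ioc_of_le ht] at this

theorem integral_sq_time_average_le
    (hm : AEStronglyMeasurable (fun z : ℝ × ℝ => R z.1 z.2)
      ((volume.restrict (Ioc t₀ t₁)).prod (volume.restrict (Ioo a b))))
    (hM : ∀ t ∈ Ioc t₀ t₁, ∀ x, ‖R t x‖ ≤ M) (ht : t₀ ≤ t₁)
    (hi : ∀ x, IntervalIntegrable (fun t => R t x) volume t₀ t₁) {N : ℝ → ℝ}
    (hN : Integrable N (volume.restrict (Ioc t₀ t₁)))
    (h : ∀ᵐ t ∂(volume.restrict (Ioc t₀ t₁)), ∫ x in Ioo a b, R t x ^ 2 ≤ N t) :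
    ∫ x in Ioo a b, (∫ t in t₀..t₁, R t x) ^ 2 ≤ (t₁ - t₀) * ∫ t in Ioc t₀ t₁, N t := by
  have hmem : ∀ᵐ z : ℝ × ℝ ∂((volume.restrict (Ioc t₀ t₁)).prod (volume.restrict (Ioo a b))),
      z.1 ∈ Ioc t₀ t₁ :=
    Measure.quasiMeasurePreserving_fst.ae (ae_restrict_mem measurableSet_Ioc)
  have hsq : Integrable (fun z : ℝ × ℝ => R z.1 z.2 ^ 2)
      ((volume.restrict (Ioc t₀ t₁)).prod (volume.restrict (Ioo a b))) := by
    refine Integrable.of_bound (hm.pow 2) (M ^ 2) ?_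
    filter_upwards [hmem] with z hz
    rw [norm_pow]
    gcongr
    exact hM z.1 hz z.2
  have hi2 : ∀ x, IntervalIntegrable (fun t => R t x ^ 2) volume t₀ t₁ := by
    intro x
    have := hi x
    rw [intervalIntegrable_iff_integrableOn_Ioc_of_le ht] at this ⊢
    refine Integrable.of_bound (this.1.pow 2) (M ^ 2) ?_
    filter_upwards [ae_restrict_mem measurableSet_Ioc] with t ht
    rw [norm_pow]
    gcongr
    exact hM t ht x
  calc ∫ x in Ioo a b, (∫ t in t₀..t₁, R t x) ^ 2
      ≤ ∫ x in Ioo a b, (t₁ - t₀) * ∫ t in Ioc t₀ t₁, R t x ^ 2 := by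
        refine integral_mono (memLp_time_average hm hM ht).integrable_sq
          (hsq.integral_prod_right.const_mul _) fun x => ?_
        have := sq_integral_le ht (hi x) (hi2 x)
        rwa [intervalIntegral.integral_of_le ht (f := fun t => R t x ^ 2)] at this
    _ = (t₁ - t₀) * ∫ t in Ioc t₀ t₁, ∫ x in Ioo a b, R t x ^ 2 := by
        rw [integral_const_mul, integral_integral_swap (f := fun x t => R t x ^ 2) hsq.swap]
    _ ≤ (t₁ - t₀) * ∫ t in Ioc t₀ t₁, N t :=
        mul_le_mul_of_nonneg_left (integral_mono_ae hsq.integral_prod_left hN h)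
          (sub_nonneg.2 ht)

theorem abs_integral_time_average_mul_le
    (hm : AEStronglyMeasurable (fun z : ℝ × ℝ => R z.1 z.2)
      ((volume.restrict (Ioc t₀ t₁)).prod (volume.restrict (Ioo a b))))
    (hM : ∀ t ∈ Ioc t₀ t₁, ∀ x, ‖R t x‖ ≤ M) (ht : t₀ ≤ t₁) {v : ℝ → ℝ} {K : ℝ}
    (hv : Integrable v (volume.restrict (Ioo a b)))
    (h : ∀ᵐ t ∂(volume.restrict (Ioc t₀ t₁)), |∫ x in Ioo a b, R t x * v x| ≤ K) :
    |∫ x in Ioo a b, (∫ t in t₀..t₁, R t x) * v x| ≤ (t₁ - t₀) * K := by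
  have hmem : ∀ᵐ z : ℝ × ℝ ∂((volume.restrict (Ioc t₀ t₁)).prod (volume.restrict (Ioo a b))),
      z.1 ∈ Ioc t₀ t₁ :=
    Measure.quasiMeasurePreserving_fst.ae (ae_restrict_mem measurableSet_Ioc)
  have hp : Integrable (fun z : ℝ × ℝ => R z.1 z.2 * v z.2)
      ((volume.restrict (Ioc t₀ t₁)).prod (volume.restrict (Ioo a b))) := by
    refine (hv.comp_snd (volume.restrict (Ioc t₀ t₁))).bdd_mul (c := M) hm ?_
    filter_upwards [hmem] with z hz using hM z.1 hz z.2
  have e : ∫ x in Ioo a b, (∫ t in t₀..t₁, R t x) * v x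
      = ∫ t in Ioc t₀ t₁, ∫ x in Ioo a b, R t x * v x := by
    simp only [intervalIntegral.integral_of_le ht, ← integral_mul_const]
    exact (integral_integral_swap hp).symm
  rw [e]
  have := norm_setIntegral_le_of_norm_le_const_ae (μ := volume) (s := Ioc t₀ t₁)
    (f := fun t => ∫ x in Ioo a b, R t x * v x) (C := K) (by simp) h
  rw [Real.volume_real_Ioc_of_le ht, mul_comm] at this
  exact this

end Average

/-! ### Norms -/

section Norms

theorem eLpNorm_two_eq {Z Y : Type*} [MeasurableSpace Z] [NormedAddCommGroup Y] {μ : Measure Z}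
    {f : Z → Y} (hf : MemLp f 2 μ) : eLpNorm f 2 μ = ENNReal.ofReal (√(∫ z, ‖f z‖ ^ 2 ∂μ)) := by
  rw [hf.eLpNorm_eq_integral_rpow_norm (by simp) (by simp), Real.sqrt_eq_rpow]
  simp

theorem norm_sq_Lp_two {Z Y : Type*} [MeasurableSpace Z] [NormedAddCommGroup Y] {μ : Measure Z}
    (f : Lp Y 2 μ) : ‖f‖ ^ 2 = ∫ z, ‖f z‖ ^ 2 ∂μ := by
  have h0 : 0 ≤ ∫ z, ‖f z‖ ^ 2 ∂μ := integral_nonneg fun _ => by positivity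
  rw [Lp.norm_def, eLpNorm_two_eq (Lp.memLp f), ENNReal.toReal_ofReal (Real.sqrt_nonneg _),
    Real.sq_sqrt h0]

variable {Y : Type*} [NormedAddCommGroup Y] [NormedSpace ℝ Y] [CompleteSpace Y] {a b : ℝ} {m : ℕ}

theorem Sobolev.norm_sq_eq (F : Sobolev Y m a b) :
    ‖F‖ ^ 2 = ∑ i, ∫ s in Ioo a b, ‖F.jet i s‖ ^ 2 := by
  have h : ‖F‖ ^ 2 = ∑ i, ‖(F : L2Jets Y m a b) i‖ ^ 2 := PiLp.norm_sq_eq_of_L2 _ _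
  rw [h]
  exact Finset.sum_congr rfl fun i _ => norm_sq_Lp_two _

theorem Sobolev.integral_jet_sq_le (F : Sobolev Y m a b) (i : Fin (m + 1)) :
    ∫ s in Ioo a b, ‖F.jet i s‖ ^ 2 ≤ ‖F‖ ^ 2 := by
  rw [F.norm_sq_eq]
  exact Finset.single_le_sum (f := fun i => ∫ s in Ioo a b, ‖F.jet i s‖ ^ 2)
    (fun _ _ => integral_nonneg fun _ => by positivity) (Finset.mem_univ i)

theorem Sobolev.integral_jet_sq_add_le (F : Sobolev Y m a b) {i j : Fin (m + 1)} (hij : i ≠ j) :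
    (∫ s in Ioo a b, ‖F.jet i s‖ ^ 2) + ∫ s in Ioo a b, ‖F.jet j s‖ ^ 2 ≤ ‖F‖ ^ 2 := by
  rw [F.norm_sq_eq, ← Finset.sum_pair (f := fun i => ∫ s in Ioo a b, ‖F.jet i s‖ ^ 2) hij]
  exact Finset.sum_le_sum_of_subset_of_nonneg (Finset.subset_univ _)
    fun _ _ _ => integral_nonneg fun _ => by positivity

end Norms

/-! ### Estimates of the commutator at a fixed time -/

section Space

variable {a b h W : ℝ} {Np : ℕ} {p w : ℕ → ℝ} {f : ℝ → ℝ}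

theorem intervalIntegral_eq_Ioo (hab : a ≤ b) (g : ℝ → ℝ) :
    ∫ x in a..b, g x = ∫ x in Ioo a b, g x := by
  rw [intervalIntegral.integral_of_le hab, integral_Ioc_eq_integral_Ioo]

theorem integral_congr_of_ae_Ioo {g g' : ℝ → ℝ} (hg : g =ᵐ[volume.restrict (Ioo a b)] g') {x y : ℝ}
    (hax : a ≤ x) (hxy : x ≤ y) (hyb : y ≤ b) : ∫ s in x..y, g s = ∫ s in x..y, g' s := by
  rw [intervalIntegral_eq_Ioo hxy, intervalIntegral_eq_Ioo hxy]
  exact integral_congr_ae (ae_restrict_of_ae_restrict_of_subset (Ioo_subset_Ioo hax hyb) hg)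

theorem Sobolev.sub_eq_integral_eval_one (hab : a < b) {F : HSob 2 a b}
    (hf : ∀ x ∈ Icc a b, f x = Sobolev.eval 0 x F) {x y : ℝ} (hax : a ≤ x) (hxy : x ≤ y)
    (hyb : y ≤ b) : f y - f x = ∫ s in x..y, Sobolev.eval 1 s F := by
  rw [hf y ⟨hax.trans hxy, hyb⟩, hf x ⟨hax, hxy.trans hyb⟩]
  exact Sobolev.eval_sub_eval_eq_integral_eval hab 0 1 rfl hax hxy hyb F

theorem represents_of_eq_eval (hab : a < b) {F : HSob 2 a b}
    (hf : ∀ x ∈ Icc a b, f x = Sobolev.eval 0 x F) : Represents F f := by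
  refine (Sobolev.jet_ae_eq_eval hab 0 F).trans ?_
  filter_upwards [ae_restrict_mem measurableSet_Ioo] with x hx
  exact (hf x (Ioo_subset_Icc_self hx)).symm

theorem Sobolev.integral_interpDefect_sq_le (hab : a < b) (hp : StrictMonoOn p (Icc 1 Np))
    (hNp : 1 ≤ Np) (ha : p 1 = a) (hb : p Np = b)
    (hh : ∀ j, 1 ≤ j → j < Np → p (j + 1) - p j ≤ h) (hW : 0 ≤ W)
    (hw : ∀ i, 1 ≤ i → i ≤ Np → |w i| ≤ W) {F : HSob 2 a b}
    (hf : ∀ x ∈ Icc a b, f x = Sobolev.eval 0 x F) {G : HSob 2 a b} (hG : Represents G f) :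
    ∫ x in Ioo a b, interpDefect Np p w f (fun x => Sobolev.eval 1 x F) x ^ 2
      ≤ (W * h) ^ 2 * ‖G‖ ^ 2 := by
  have hjet := Sobolev.jet_ae_unique F G ((represents_of_eq_eval hab hf).trans hG.symm) 2
    (by omega) (by omega)
  have key := _root_.integral_interpDefect_sq_le (f₀ := f) (f₁ := fun x => Sobolev.eval 1 x F)
    (f₂ := G.jet 2) hp hNp hh hW hw
    (Sobolev.continuous_eval_apply 1 F).continuousOn
    (fun x y hx hxy hy => Sobolev.sub_eq_integral_eval_one hab hf (ha ▸ hx) hxy (hb ▸ hy))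
    (fun x y hx hxy hy => by
      rw [Sobolev.eval_sub_eval_of_mem 1 (ha ▸ hx) hxy (hb ▸ hy)]
      exact integral_congr_of_ae_Ioo hjet (ha ▸ hx) hxy (hb ▸ hy))
    (by rw [ha, hb]; exact G.memLp_jet 2)
  rw [ha, hb, intervalIntegral_eq_Ioo hab.le, intervalIntegral_eq_Ioo hab.le] at key
  refine key.trans (mul_le_mul_of_nonneg_left ?_ (sq_nonneg _))
  have := G.integral_jet_sq_le 2
  simpa only [Real.norm_eq_abs, sq_abs] using this

theorem Sobolev.abs_integral_interpDefect_mul_le (hab : a < b) (hp : StrictMonoOn p (Icc 1 Np))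
    (hNp : 1 ≤ Np) (ha : p 1 = a) (hb : p Np = b)
    (hh : ∀ j, 1 ≤ j → j < Np → p (j + 1) - p j ≤ h) (hW : 0 ≤ W)
    (hw : ∀ i, 1 ≤ i → i ≤ Np → |w i| ≤ W)
    (hw' : ∀ j, 1 ≤ j → j < Np → |w (j + 1) - w j| ≤ W * (p (j + 1) - p j)) {F : HSob 2 a b}
    (hf : ∀ x ∈ Icc a b, f x = Sobolev.eval 0 x F) {G : HSob 3 a b} (hG : Represents G f)
    (v : HSob 1 a b) :
    |∫ x in Ioo a b, interpDefect Np p w f (fun x => Sobolev.eval 1 x F) x * v.jet 0 x|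
      ≤ 4 * W * h ^ 2 * (‖G‖ * ‖v‖) := by
  have hjet : F.jet 2 =ᵐ[volume.restrict (Ioo a b)] G.jet 2 :=
    Sobolev.jet_ae_unique F G ((represents_of_eq_eval hab hf).trans hG.symm) 2
      (by omega) (by omega)
  have hG2 : G.jet 2 =ᵐ[volume.restrict (Ioo a b)] fun x => Sobolev.eval 2 x G :=
    Sobolev.jet_ae_eq_eval hab 2 G
  have hv0 : v.jet 0 =ᵐ[volume.restrict (Ioo a b)] fun x => Sobolev.eval 0 x v :=
    Sobolev.jet_ae_eq_eval hab 0 v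
  have key := _root_.abs_integral_interpDefect_mul_le (f₀ := f)
    (f₁ := fun x => Sobolev.eval 1 x F) (f₂ := fun x => Sobolev.eval 2 x G) (f₃ := G.jet 3)
    (v := fun x => Sobolev.eval 0 x v) (v' := v.jet 1) hp hNp hh hW hw hw'
    (Sobolev.continuous_eval_apply 1 F).continuousOn
    (Sobolev.continuous_eval_apply 2 G).continuousOn
    (fun x y hx hxy hy => Sobolev.sub_eq_integral_eval_one hab hf (ha ▸ hx) hxy (hb ▸ hy))
    (fun x y hx hxy hy => by
      rw [Sobolev.eval_sub_eval_of_mem 1 (ha ▸ hx) hxy (hb ▸ hy)]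
      exact integral_congr_of_ae_Ioo (hjet.trans hG2) (ha ▸ hx) hxy (hb ▸ hy))
    (fun x y hx hxy hy => Sobolev.eval_sub_eval_of_mem 2 (ha ▸ hx) hxy (hb ▸ hy) G)
    (by rw [ha, hb]; exact G.memLp_jet 3)
    (Sobolev.continuous_eval_apply 0 v).continuousOn
    (fun x y hx hxy hy => Sobolev.eval_sub_eval_of_mem 0 (ha ▸ hx) hxy (hb ▸ hy) v)
    (by rw [ha, hb]; exact v.memLp_jet 1)
  simp only [ha, hb, intervalIntegral_eq_Ioo hab.le] at key
  have e1 : ∫ x in Ioo a b, interpDefect Np p w f (fun x => Sobolev.eval 1 x F) x * v.jet 0 x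
      = ∫ x in Ioo a b, interpDefect Np p w f (fun x => Sobolev.eval 1 x F) x
        * Sobolev.eval 0 x v :=
    integral_congr_ae (hv0.mono fun x hx => by simp only [hx])
  have e2 : ∫ x in Ioo a b, Sobolev.eval 2 x G ^ 2 = ∫ x in Ioo a b, G.jet 2 x ^ 2 :=
    integral_congr_ae (hG2.mono fun x hx => by simp only [hx])
  have e3 : ∫ x in Ioo a b, Sobolev.eval 0 x v ^ 2 = ∫ x in Ioo a b, v.jet 0 x ^ 2 :=
    integral_congr_ae (hv0.mono fun x hx => by simp only [hx])
  rw [e2, e3] at key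
  rw [e1]
  refine key.trans (mul_le_mul_of_nonneg_left ?_ (by positivity))
  have n1 := G.integral_jet_sq_add_le (i := 2) (j := 3) (by decide)
  have n2 := v.integral_jet_sq_add_le (i := 0) (j := 1) (by decide)
  simp only [Real.norm_eq_abs, sq_abs] at n1 n2
  exact mul_le_mul (Real.sqrt_le_iff.2 ⟨norm_nonneg _, n1⟩) (Real.sqrt_le_iff.2 ⟨norm_nonneg _, n2⟩)
    (Real.sqrt_nonneg _) (norm_nonneg _)

end Space

/-! ### Regularity of the solution along the mesh -/

section Regularity

variable {a b T : ℝ} {φ : ℝ → ℝ → ℝ} {F : ℝ → HSob 2 a b}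

/-- The chain rule for `s ↦ φ(s, p(s))`. The path may run along the boundary of the domain, where
`φ` has one-sided space derivatives only. -/
theorem hasDerivAt_along_path (hab : a < b) (hF : ContDiffOn ℝ 1 F (Icc 0 T))
    (hφ : ∀ t ∈ Icc 0 T, ∀ x ∈ Icc a b, φ t x = Sobolev.eval 0 x (F t)) {t : ℝ}
    (ht : t ∈ Ioo 0 T) {p : ℝ → ℝ} {w : ℝ} (hp : HasDerivAt p w t)
    (hm : ∀ᶠ s in 𝓝 t, p s ∈ Icc a b) :
    HasDerivAt (fun s => φ s (p s)) (Sobolev.eval 0 (p t) (derivWithin F (Icc 0 T) t)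
      + w * Sobolev.eval 1 (p t) (F t)) t := by
  have hn : Icc 0 T ∈ 𝓝 t := Icc_mem_nhds ht.1 ht.2
  have hd : HasDerivAt F (derivWithin F (Icc 0 T) t) t :=
    ((hF.differentiableOn (by simp) t (Ioo_subset_Icc_self ht)).hasDerivWithinAt).hasDerivAt hn
  have hc : Continuous fun x => (Sobolev.eval (1 : Fin 2) x : HSob 2 a b →L[ℝ] ℝ) :=
    continuous_of_norm_apply_sub_le (Sobolev.norm_eval_sub_eval_le 1)
  have hE : ∀ x ∈ Icc a b, HasDerivWithinAt
      (fun x => (Sobolev.eval (0 : Fin 2) x : HSob 2 a b →L[ℝ] ℝ)) (Sobolev.eval 1 x)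
      (Icc a b) x := fun x hx =>
    hasDerivWithinAt_of_apply_sub_eq_integral hc (fun y hy G =>
      Sobolev.eval_sub_eval_eq_integral_eval hab 0 1 rfl le_rfl hy.1 hy.2 G) hx
  refine (hasDerivAt_family_apply hE hd hp hm).congr_of_eventuallyEq ?_
  filter_upwards [hn, hm] with s hs hs'
  exact hφ s hs _ hs'

theorem continuousOn_eval_along_path {S : Set ℝ} {G : ℝ → HSob 2 a b} (hG : ContinuousOn G S)
    {p : ℝ → ℝ} (hp : Continuous p) (i : Fin 2) :
    ContinuousOn (fun s => Sobolev.eval i (p s) (G s)) S := by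
  have hc : Continuous fun x => (Sobolev.eval i x : HSob 2 a b →L[ℝ] ℝ) :=
    continuous_of_norm_apply_sub_le (Sobolev.norm_eval_sub_eval_le i)
  exact (hc.comp hp).continuousOn.clm_apply hG

theorem regularOnStep_of_contDiffOn (hab : a < b) (hT : 0 < T) (hF : ContDiffOn ℝ 1 F (Icc 0 T))
    (hφ : ∀ t ∈ Icc 0 T, ∀ x ∈ Icc a b, φ t x = Sobolev.eval 0 x (F t)) {Δt : ℝ} {NT Np : ℕ}
    {P : ℕ → ℕ → ℝ} (hP : IsMovingMesh a b NT Np P) (hΔt : 0 < Δt) {n : ℕ} (hn : n ≤ NT)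
    (h0 : 0 ≤ ((n : ℝ) - 1) * Δt) (h1 : n * Δt ≤ T) :
    RegularOnStep a b Δt Np P n φ
      (fun t x => Sobolev.eval 0 x (derivWithin F (Icc 0 T) t))
      (fun t x => Sobolev.eval 1 x (F t)) := by
  have hsub : Icc (((n : ℝ) - 1) * Δt) (n * Δt) ⊆ Icc 0 T := Icc_subset_Icc h0 h1
  have hsub' : Ioo (((n : ℝ) - 1) * Δt) (n * Δt) ⊆ Ioo 0 T := Ioo_subset_Ioo h0 h1
  have hFc : ContinuousOn F (Icc (((n : ℝ) - 1) * Δt) (n * Δt)) := hF.continuousOn.mono hsub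
  have hFc' : ContinuousOn (derivWithin F (Icc 0 T)) (Icc (((n : ℝ) - 1) * Δt) (n * Δt)) :=
    (hF.continuousOn_derivWithin (uniqueDiffOn_Icc hT) le_rfl).mono hsub
  refine ⟨fun t ht x hx => ?_, fun i hi hi' t ht => ?_, fun i hi hi' => ?_, fun i _ _ => ?_,
    fun i _ _ => ?_⟩
  · have h := hasDerivAt_along_path hab hF hφ (hsub' ht) (hasDerivAt_const t x)
      (Eventually.of_forall fun _ => hx)
    rw [timeDeriv, h.deriv, zero_mul, add_zero]
  · refine hasDerivAt_along_path hab hF hφ (hsub' ht) (hasDerivAt_nodePos Δt P n t i) ?_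
    filter_upwards [isOpen_Ioo.mem_nhds ht] with s hs
    exact nodePos_mem_Icc hP hΔt hn (Ioo_subset_Icc_self hs) hi hi'
  · refine (continuousOn_eval_along_path hFc (continuous_nodePos Δt P n i) 0).congr fun t ht => ?_
    exact hφ t (hsub ht) _ (nodePos_mem_Icc hP hΔt hn ht hi hi')
  · exact continuousOn_eval_along_path hFc' (continuous_nodePos Δt P n i) 0
  · exact continuousOn_eval_along_path hFc (continuous_nodePos Δt P n i) 1

end Regularity

/-! ### Error estimates in `L²` and in the dual norm -/

section Estimates

variable {a b Δt W : ℝ} {NT Np : ℕ} {P : ℕ → ℕ → ℝ} {n : ℕ} {φ D : ℝ → ℝ → ℝ}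

theorem le_mul_timeSobolevNorm {k m : ℕ} {t₀ t₁ c : ℝ} (hc : 0 < c) {x : ℝ≥0∞}
    (h : ∀ F : Sobolev (HSob m a b) k t₀ t₁, TimeRepresents F φ →
      x ≤ ENNReal.ofReal c * ENNReal.ofReal ‖F‖) :
    x ≤ ENNReal.ofReal c * timeSobolevNorm k t₀ t₁ m a b φ := by
  have h0 : ENNReal.ofReal c ≠ 0 := by simpa using hc
  rw [timeSobolevNorm, ENNReal.mul_iInf_of_ne h0 ENNReal.ofReal_ne_top]
  refine le_iInf fun F => ?_
  rw [ENNReal.mul_iInf_of_ne h0 ENNReal.ofReal_ne_top]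
  refine le_iInf fun hF => ?_
  rw [← ofReal_norm]
  exact h F hF

theorem RegularOnStep.aestronglyMeasurable_prod {X : ℝ → ℝ → ℝ}
    (hR : RegularOnStep a b Δt Np P n φ D X) (hP : IsMovingMesh a b NT Np P) (hΔt : 0 < Δt)
    (hn : n ≤ NT) :
    AEStronglyMeasurable (fun z : ℝ × ℝ => stepDefect Δt Np P n φ X z.1 z.2)
      ((volume.restrict (Ioc (((n : ℝ) - 1) * Δt) (n * Δt))).prod (volume.restrict (Ioo a b))) :=
  hR.aestronglyMeasurable hP hΔt hn measurable_fst measurable_snd fun _ hg =>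
    ((hg.mono Ioc_subset_Icc_self).aestronglyMeasurable measurableSet_Ioc).comp_fst

theorem RegularOnStep.memLp_interpError {X : ℝ → ℝ → ℝ}
    (hR : RegularOnStep a b Δt Np P n φ D X) (hP : IsMovingMesh a b NT Np P) (hΔt : 0 < Δt)
    (hn : n ≤ NT) : MemLp (interpError Δt Np P φ n) 2 (volume.restrict (Ioo a b)) := by
  obtain ⟨M, hM⟩ := hR.exists_bound hP hΔt hn
  refine ((memLp_time_average (hR.aestronglyMeasurable_prod hP hΔt hn)
    (fun t ht x => hM t (Ioc_subset_Icc_self ht) x) (by nlinarith)).const_mul (1 / Δt)).ae_eq ?_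
  exact (hR.interpError_ae_eq hP hΔt hn).symm

/-- The estimate in `L²`, by the Cauchy–Schwarz inequality in time. -/
theorem eLpNorm_interpError_le {F : ℝ → HSob 2 a b} (hab : a < b)
    (hR : RegularOnStep a b Δt Np P n φ D fun t x => Sobolev.eval 1 x (F t))
    (hF : ∀ t ∈ Icc (((n : ℝ) - 1) * Δt) (n * Δt), ∀ x ∈ Icc a b, φ t x = Sobolev.eval 0 x (F t))
    (hP : IsMovingMesh a b NT Np P) (hΔt : 0 < Δt) (hn : n ≤ NT) (hW : 0 < W)
    (hw : ∀ i, 1 ≤ i → i ≤ Np → |nodeVelocity Δt P n i| ≤ W) :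
    eLpNorm (interpError Δt Np P φ n) 2 (volume.restrict (Ioo a b)) ≤
      ENNReal.ofReal (W * meshSize NT Np P / √Δt)
        * timeSobolevNorm 0 (((n : ℝ) - 1) * Δt) (n * Δt) 2 a b φ := by
  have hle : ((n : ℝ) - 1) * Δt ≤ n * Δt := by nlinarith
  have hh := hP.meshSize_pos
  set h := meshSize NT Np P
  have hs := Real.sqrt_pos.2 hΔt
  refine le_mul_timeSobolevNorm (by positivity) fun G hG => ?_
  obtain ⟨M, hM⟩ := hR.exists_bound hP hΔt hn
  have hN : Integrable (fun t => (W * h) ^ 2 * ‖G.jet 0 t‖ ^ 2)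
      (volume.restrict (Ioc (((n : ℝ) - 1) * Δt) (n * Δt))) := by
    rw [← restrict_Ioo_eq_restrict_Ioc]
    exact ((G.memLp_jet 0).integrable_norm_pow (by simp)).const_mul _
  have hstep : ∀ᵐ t ∂(volume.restrict (Ioc (((n : ℝ) - 1) * Δt) (n * Δt))),
      ∫ x in Ioo a b, stepDefect Δt Np P n φ (fun t x => Sobolev.eval 1 x (F t)) t x ^ 2
        ≤ (W * h) ^ 2 * ‖G.jet 0 t‖ ^ 2 := by
    rw [← restrict_Ioo_eq_restrict_Ioc]
    filter_upwards [hG, ae_restrict_mem measurableSet_Ioo] with t hGt ht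
    have ht' := Ioo_subset_Icc_self ht
    exact Sobolev.integral_interpDefect_sq_le hab (nodePos_strictMonoOn hP hΔt hn ht')
      (by have := hP.two_le; omega) (nodePos_one hP hn t) (nodePos_last hP hn t)
      (fun j h1 h2 => nodePos_sub_le_meshSize hΔt hn ht' h1 h2) hW.le hw (hF t ht') hGt
  have key := integral_sq_time_average_le (hR.aestronglyMeasurable_prod hP hΔt hn)
    (fun t ht x => hM t (Ioc_subset_Icc_self ht) x) hle
    (fun x => hR.intervalIntegrable_stepDefect hP hΔt hn x) hN hstep
  rw [integral_const_mul, show (n : ℝ) * Δt - ((n : ℝ) - 1) * Δt = Δt by ring,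
    integral_Ioc_eq_integral_Ioo] at key
  have hG2 : ∫ t in Ioo (((n : ℝ) - 1) * Δt) (n * Δt), ‖G.jet 0 t‖ ^ 2 ≤ ‖G‖ ^ 2 :=
    G.integral_jet_sq_le 0
  rw [eLpNorm_two_eq (hR.memLp_interpError hP hΔt hn), ← ENNReal.ofReal_mul (by positivity)]
  refine ENNReal.ofReal_le_ofReal (Real.sqrt_le_iff.2 ⟨by positivity, ?_⟩)
  have e : ∫ x in Ioo a b, ‖interpError Δt Np P φ n x‖ ^ 2 = (1 / Δt) ^ 2 * ∫ x in Ioo a b,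
      (∫ t in (((n : ℝ) - 1) * Δt)..(n * Δt),
        stepDefect Δt Np P n φ (fun t x => Sobolev.eval 1 x (F t)) t x) ^ 2 := by
    rw [← integral_const_mul]
    refine integral_congr_ae ((hR.interpError_ae_eq hP hΔt hn).mono fun x hx => ?_)
    simp only [hx, Real.norm_eq_abs, sq_abs, mul_pow]
  calc ∫ x in Ioo a b, ‖interpError Δt Np P φ n x‖ ^ 2
      ≤ (1 / Δt) ^ 2 * (Δt * ((W * h) ^ 2 * ‖G‖ ^ 2)) := by
        rw [e]
        refine mul_le_mul_of_nonneg_left (key.trans ?_) (by positivity)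
        gcongr
    _ = (W * h / √Δt * ‖G‖) ^ 2 := by
        rw [mul_pow (W * h / √Δt), div_pow (W * h), Real.sq_sqrt hΔt.le]
        field_simp

/-- The estimate in the dual norm, from the bound for the commutator at almost every time. -/
theorem dualNorm_interpError_le {F : ℝ → HSob 2 a b} (hab : a < b)
    (hR : RegularOnStep a b Δt Np P n φ D fun t x => Sobolev.eval 1 x (F t))
    (hF : ∀ t ∈ Icc (((n : ℝ) - 1) * Δt) (n * Δt), ∀ x ∈ Icc a b, φ t x = Sobolev.eval 0 x (F t))
    (hP : IsMovingMesh a b NT Np P) (hΔt : 0 < Δt) (hn : n ≤ NT) (hW : 0 < W)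
    (hw : ∀ i, 1 ≤ i → i ≤ Np → |nodeVelocity Δt P n i| ≤ W)
    (hw' : ∀ t ∈ Icc (((n : ℝ) - 1) * Δt) (n * Δt), ∀ j, 1 ≤ j → j < Np →
      |nodeVelocity Δt P n (j + 1) - nodeVelocity Δt P n j|
        ≤ W * (nodePos Δt P n t (j + 1) - nodePos Δt P n t j))
    {T : ℝ} (hT : 0 < T) (h0 : 0 ≤ ((n : ℝ) - 1) * Δt) (h1 : n * Δt ≤ T) :
    dualNorm a b (interpError Δt Np P φ n) ≤
      ENNReal.ofReal (4 * W * ((√T)⁻¹ + √T) * meshSize NT Np P ^ 2)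
        * timeSobolevNorm 1 0 T 3 a b φ := by
  have hle : ((n : ℝ) - 1) * Δt ≤ n * Δt := by nlinarith
  have hh := hP.meshSize_pos
  set h := meshSize NT Np P
  have hs := Real.sqrt_pos.2 hT
  refine le_mul_timeSobolevNorm (by positivity) fun G hG => iSup₂_le fun v hv => ?_
  obtain ⟨M, hM⟩ := hR.exists_bound hP hΔt hn
  have hsub : Ioo (((n : ℝ) - 1) * Δt) (n * Δt) ⊆ Ioo 0 T := Ioo_subset_Ioo h0 h1
  -- `G` is bounded in time by the embedding of `H¹(0, T; H³)` into the continuous functions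
  have hGT : ∀ᵐ t ∂(volume.restrict (Ioo 0 T)), ‖G.jet 0 t‖ ≤ ((√T)⁻¹ + √T) * ‖G‖ := by
    filter_upwards [Sobolev.jet_ae_eq_eval hT 0 G] with t ht
    have := Sobolev.norm_eval_le 0 t G
    rw [sub_zero] at this
    rw [show G.jet 0 t = Sobolev.eval 0 t G from ht]
    exact this
  have hstep : ∀ᵐ t ∂(volume.restrict (Ioc (((n : ℝ) - 1) * Δt) (n * Δt))),
      |∫ x in Ioo a b, stepDefect Δt Np P n φ (fun t x => Sobolev.eval 1 x (F t)) t x * v.jet 0 x|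
        ≤ 4 * W * ((√T)⁻¹ + √T) * h ^ 2 * ‖G‖ := by
    rw [← restrict_Ioo_eq_restrict_Ioc]
    filter_upwards [ae_restrict_of_ae_restrict_of_subset hsub hG,
      ae_restrict_of_ae_restrict_of_subset hsub hGT, ae_restrict_mem measurableSet_Ioo]
      with t hGt hGT ht
    have ht' := Ioo_subset_Icc_self ht
    have := Sobolev.abs_integral_interpDefect_mul_le hab (nodePos_strictMonoOn hP hΔt hn ht')
      (by have := hP.two_le; omega) (nodePos_one hP hn t) (nodePos_last hP hn t)
      (fun j h1 h2 => nodePos_sub_le_meshSize hΔt hn ht' h1 h2) hW.le hw (hw' t ht') (hF t ht')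
      hGt v
    refine this.trans ?_
    calc 4 * W * h ^ 2 * (‖G.jet 0 t‖ * ‖v‖)
        ≤ 4 * W * h ^ 2 * (((√T)⁻¹ + √T) * ‖G‖ * 1) := by gcongr
      _ = _ := by ring
  have key := abs_integral_time_average_mul_le (hR.aestronglyMeasurable_prod hP hΔt hn)
    (fun t ht x => hM t (Ioc_subset_Icc_self ht) x) hle (v.integrable_jet 0) hstep
  rw [show (n : ℝ) * Δt - ((n : ℝ) - 1) * Δt = Δt by ring] at key
  have e : ∫ x in Ioo a b, interpError Δt Np P φ n x * v.jet 0 x = (1 / Δt) * ∫ x in Ioo a b,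
      (∫ t in (((n : ℝ) - 1) * Δt)..(n * Δt),
        stepDefect Δt Np P n φ (fun t x => Sobolev.eval 1 x (F t)) t x) * v.jet 0 x := by
    rw [← integral_const_mul]
    refine integral_congr_ae ((hR.interpError_ae_eq hP hΔt hn).mono fun x hx => ?_)
    simp only [hx, mul_assoc]
  rw [← ofReal_norm, ← ENNReal.ofReal_mul (by positivity), e, norm_mul, Real.norm_eq_abs,
    Real.norm_eq_abs, abs_of_pos (by positivity : 0 < 1 / Δt)]
  refine ENNReal.ofReal_le_ofReal ?_
  calc _ ≤ 1 / Δt * (Δt * (4 * W * ((√T)⁻¹ + √T) * h ^ 2 * ‖G‖)) := by gcongr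
    _ = _ := by field_simp

end Estimates

theorem mainTheorem3 :
    ∃ C : ℝ → ℝ, (∀ W, 0 < C W) ∧
    ∀ T : ℝ, 0 < T →
    ∃ C' : ℝ → ℝ, (∀ W, 0 < C' W) ∧
    ∀ (a b : ℝ), a < b →
    -- a weak solution `φ` of the convection-diffusion problem
    ∀ (ν : ℝ) (u f g : ℝ → ℝ → ℝ) (φ₀ : ℝ → ℝ) (φ : ℝ → ℝ → ℝ), 0 < ν →
    (∀ t ∈ Set.Ioo 0 T, MeasureTheory.MemLp (u t) 2 (volume.restrict (Set.Ioo a b))) →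
    (∀ t ∈ Set.Ioo 0 T, MeasureTheory.MemLp (f t) 2 (volume.restrict (Set.Ioo a b))) →
    IsWeakSolution a b T ν u f g φ₀ φ →
    -- the regularity `φ ∈ Z³ ∩ H²(0, T; H²) ∩ H¹(0, T; H³)`
    MemZ 3 T a b φ → MemTimeSobolev 2 0 T 2 a b φ → MemTimeSobolev 1 0 T 3 a b φ →
    -- a moving mesh
    ∀ (Δt : ℝ) (Np : ℕ) (P : ℕ → ℕ → ℝ), 0 < Δt →
    IsMovingMesh a b (numSteps T Δt) Np P →
    ∀ n : ℕ, 1 ≤ n → n ≤ numSteps T Δt →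
      -- all terms are well defined
      ((∀ t ∈ Set.Ioo (((n : ℝ) - 1) * Δt) (n * Δt), ∀ x ∈ Set.Icc a b,
          DifferentiableAt ℝ (fun s => φ s x) t) ∧
        (∀ x ∈ Set.Icc a b, IntervalIntegrable
          (fun t => interp Np (nodePos Δt P n t) (timeDeriv φ t) x) volume
          (((n : ℝ) - 1) * Δt) (n * Δt)) ∧
        MeasureTheory.MemLp (interpError Δt Np P φ n) 2 (volume.restrict (Set.Ioo a b))) ∧
      -- the estimate in `L²`
      eLpNorm (interpError Δt Np P φ n) 2 (volume.restrict (Set.Ioo a b)) ≤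
        ENNReal.ofReal (C (velocityNormLinfty a b Δt (numSteps T Δt) Np P).toReal
          * meshSize (numSteps T Δt) Np P / √Δt)
        * timeSobolevNorm 0 (((n : ℝ) - 1) * Δt) (n * Δt) 2 a b φ ∧
      -- the estimate in the dual norm
      dualNorm a b (interpError Δt Np P φ n) ≤
        ENNReal.ofReal (C' (velocityNormW1infty a b Δt (numSteps T Δt) Np P).toReal
          * meshSize (numSteps T Δt) Np P ^ 2)
        * timeSobolevNorm 1 0 T 3 a b φ := by
  -- the absolute value and the summand `1` make the constants positive for every real `W`
  refine ⟨fun W => |W| + 1, fun W => by positivity, fun T hT =>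
    ⟨fun W => 4 * (|W| + 1) * ((√T)⁻¹ + √T), fun W => ?_, ?_⟩⟩
  · have := Real.sqrt_pos.2 hT
    positivity
  intro a b hab ν u f g φ₀ φ _ _ _ hsol hZ _ _ Δt Np P hΔt hP n hn1 hn
  obtain ⟨F, hF, hFc⟩ : MemTimeC 1 T 2 a b φ := hZ 1 (by norm_num)
  have h0 : 0 ≤ ((n : ℝ) - 1) * Δt :=
    mul_nonneg (sub_nonneg.2 (by exact_mod_cast hn1)) hΔt.le
  have h1 : n * Δt ≤ T := by
    rw [← le_div_iff₀ hΔt]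
    exact (Nat.le_floor_iff (by positivity)).1 hn
  have hφ : ∀ t ∈ Icc 0 T, ∀ x ∈ Icc a b, φ t x = Sobolev.eval 0 x (F t) := fun t ht x hx =>
    (hF t ht).eq_eval hab (hsol.continuousOn t ht) 0 rfl hx
  have hFc' : ContDiffOn ℝ 1 F (Icc 0 T) := by simpa using hFc
  have hφ' : ∀ t ∈ Icc (((n : ℝ) - 1) * Δt) (n * Δt), ∀ x ∈ Icc a b,
      φ t x = Sobolev.eval 0 x (F t) := fun t ht => hφ t (Icc_subset_Icc h0 h1 ht)
  have hR := regularOnStep_of_contDiffOn hab hT hFc' hφ hP hΔt hn h0 h1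
  refine ⟨⟨fun t ht x hx => ?_, fun x hx => hR.intervalIntegrable hP hΔt hn hx,
    hR.memLp_interpError hP hΔt hn⟩, ?_, ?_⟩
  · exact (hasDerivAt_along_path hab hFc' hφ (Ioo_subset_Ioo h0 h1 ht) (hasDerivAt_const t x)
      (Eventually.of_forall fun _ => hx)).differentiableAt
  · refine eLpNorm_interpError_le hab hR hφ' hP hΔt hn (by positivity) fun i hi hi' => ?_
    have := abs_nodeVelocity_le_Linfty hP hΔt hab hn1 hn hi hi'
    exact this.trans ((le_abs_self _).trans (by linarith))
  · refine dualNorm_interpError_le hab hR hφ' hP hΔt hn (by positivity) (fun i hi hi' => ?_)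
      (fun t ht j hj hj' => ?_) hT h0 h1
    · have := abs_nodeVelocity_le_W1infty hP hΔt hab hn1 hn hi hi'
      exact this.trans ((le_abs_self _).trans (by linarith))
    · refine (abs_nodeVelocity_sub_le hP hΔt hn1 hn ht hj hj').trans ?_
      have hH := sub_pos.2 (mesh_lt_succ (nodePos_strictMonoOn hP hΔt hn ht) hj hj')
      exact mul_le_mul_of_nonneg_right ((le_abs_self _).trans (by linarith)) hH.le
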